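/- Let $\lambda,\xi>0$, $q\in[0,1]$, and let $v_1,v_2$ be real velocities with either $v_2<0<v_1$ or $0<v_2<v_1$. A geometric counting process (GCP) with intensity $\lambda$ is a Poisson process whose random intensity is exponentially distributed with mean $\lambda$. A telegraph motion with initial velocity $v_j$ is $X(t)=\int_0^t V(s)\,ds$, where $V$ starts from $v_j$ and alternates between $v_1$ and $v_2$, the successive durations of the periods with velocity $v_1$ (respectively $v_2$) being the successive intertimes of a GCP with intensity $\lambda$, and the two GCPs being independent. Let $\tilde X(t)$ be the same motion subject to instantaneous resets to the origin at the epochs of an independent Poisson process with intensity $\xi$: at time $0$ and after each reset, an independent copy of the telegraph motion starts from $0$, always with the same initial velocity. The initial velocity $V_0$ is random, independent of the rest, with $P\{V_0=v_1\}=q$ and $P\{V_0=v_2\}=1-q$. For $t>0$ let $\tilde p(x,t\mid v_j)$ be the density at $x$ of the law of $\tilde X(t)$ with initial velocity $v_j$, that is, the limit inferior of $P\{\tilde X(t)\in I\}/|I|$ as $y\to x$, $y\ne x$, where $I$ is the interval between $x$ and $y$, open on the left and closed on the right; and let $\tilde p(x,t)=q\,\tilde p(x,t\mid v_1)+(1-q)\,\tilde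 p(x,t\mid v_2)$. Then: 1. For every $t>0$, $\tilde p(\cdot,t)$ is a density, with respect to Lebesgue measure, of the law of $\tilde X(t)$ with initial velocity $V_0$ restricted to $\mathbb R\setminus\{v_1t,v_2t\}$; and $\tilde p(x,t)$ is the derivative at $x$ of the distribution function of $\tilde X(t)$ for every $x\notin\{0,v_1t,v_2t\}$. 2. For every $x\in\mathbb R$ the limit $\lim_{t\to+\infty}\tilde p(x,t)$ exists and equals $$ \begin{cases} q\overline H_1(x)+(1-q)\overline H_2(x)+\dfrac{\xi e^{\xi/\lambda}}{v_1-v_2}\,\Gamma\Big[0,\Big(M_x+\dfrac1\lambda\Big)\xi\Big], & v_2<0<v_1,\\[3mm] q\overline H_1(x)+(1-q)\overline H_2(x)+\mathbb 1_{\{x>0\}}\dfrac{\xi e^{\xi/\lambda}}{v_1-v_2}\,\Gamma\Big[0,\Big(\dfrac x{v_1}+\dfrac1\lambda\Big)\xi,\Big(\dfrac x{v_2}+\dfrac1\lambda\Big)\xi\Big], & 0<v_2<v_1, \end{cases} $$ where $M_x=\max\{x/v_1,x/v_2\}$, $\overline H_j(x)=\operatorname{sgn}(v_j)\,\mathbb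 1_{\{x/v_j>0\}}\,\dfrac{\xi e^{-\xi x/v_j}}{v_j+\lambda x}$ for $j=1,2$, $\Gamma[a,z]=\int_z^\infty u^{a-1}e^{-u}\,du$ and $\Gamma[a,z_0,z_1]=\int_{z_0}^{z_1}u^{a-1}e^{-u}\,du$. -/

import Mathlib

open MeasureTheory ProbabilityTheory Filter Set
open scoped Topology ENNReal

noncomputable section

namespace ResetTelegraph

/-! ### Counting processes described by their intertimes -/

/-- The `n`-th epoch `d 0 + ⋯ + d (n - 1)` of the point process with intertimes `d`. -/
def epoch (d : ℕ → ℝ) (n : ℕ) : ℝ := ∑ k ∈ Finset.range n, d k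

/-- The number of epochs (the `0`-th epoch `0` not being counted) that occur up to time `t`. -/
def countUpTo (d : ℕ → ℝ) (t : ℝ) : ℕ := {n : ℕ | epoch d (n + 1) ≤ t}.ncard

/-- The law of the intertimes of a Poisson process with intensity `r`: i.i.d. exponential
variables with rate `r`. -/
def poissonIntertimeLaw (r : ℝ) : Measure (ℕ → ℝ) :=
  Measure.infinitePi fun _ : ℕ => expMeasure r

/-- The law of the intertimes of a geometric counting process with intensity `lam`, that is, of a
Poisson process whose random intensity `a` is exponentially distributed with mean `lam`.
Given `a`, the intertimes are `e k / a` with `e k` i.i.d. standard exponential, so they are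
i.i.d. exponential with rate `a`. -/
def gcpIntertimeLaw (lam : ℝ) : Measure (ℕ → ℝ) :=
  ((expMeasure (1 / lam)).prod (poissonIntertimeLaw 1)).map fun p k => p.2 k / p.1

/-! ### The telegraph motion driven by two alternating counting processes

The velocities are `v₁` and `v₂`, indexed by `0 : Fin 2` and `1 : Fin 2`. -/

/-- The durations of the successive runs of the motion with initial velocity index `j`: the
`k`-th run has velocity index `j + k` modulo `2`, and its duration is the next unused intertime of
the counting process attached to that velocity (`D 0` for `v₁` and `D 1` for `v₂`). -/
def runDuration (D : Fin 2 → ℕ → ℝ) (j : Fin 2) (k : ℕ) : ℝ :=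
  D (j + Fin.ofNat 2 k) (k / 2)

/-- The velocity at time `s` of the motion with initial velocity index `j`. -/
def velocity (v₁ v₂ : ℝ) (D : Fin 2 → ℕ → ℝ) (j : Fin 2) (s : ℝ) : ℝ :=
  (v₁ + v₂) / 2 +
    (-1) ^ (j : ℕ) * ((v₁ - v₂) / 2) * (-1) ^ countUpTo (runDuration D j) s

/-- The position `∫₀ᵗ V(s) ds` at time `t` of the motion without resets. -/
def position (v₁ v₂ : ℝ) (D : Fin 2 → ℕ → ℝ) (j : Fin 2) (t : ℝ) : ℝ :=
  ∫ s in (0 : ℝ)..t, velocity v₁ v₂ D j s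

/-- The position at time `t` of the motion with resets. The resets to the origin occur at the
epochs of the point process with intertimes `R`. After the `n`-th reset (and from time `0`
for `n = 0`) the motion starts anew from `0`, with the initial velocity index `j` and with the
`n`-th pair `D n` of counting processes. -/
def resetPosition (v₁ v₂ : ℝ) (R : ℕ → ℝ) (D : ℕ → Fin 2 → ℕ → ℝ) (j : Fin 2) (t : ℝ) : ℝ :=
  position v₁ v₂ (D (countUpTo R t)) j (t - epoch R (countUpTo R t))

/-! ### The random ingredients -/

/-- All the sequences of intertimes in one family: the reset intertimes (index `none`), and those of
the counting process attached to velocity index `i` after the `n`-th reset (index `some (n, i)`). -/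
def clocks {Ω : Type*} (R : Ω → ℕ → ℝ) (D : Ω → ℕ → Fin 2 → ℕ → ℝ) :
    Option (ℕ × Fin 2) → Ω → ℕ → ℝ
  | none => R
  | some (n, i) => fun ω => D ω n i

/-- The random ingredients of the motion: the index `J` of the random initial velocity, equal to
`0` (velocity `v₁`) with probability `q` and to `1` (velocity `v₂`) with probability `1 - q`; the
Poisson process of resets, with intensity `ξ`; and, for every `n`, two geometric counting processes
with intensity `lam`; all of them independent. -/
structure IsDriver {Ω : Type*} [MeasurableSpace Ω] (P : Measure Ω) (lam ξ q : ℝ)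
    (J : Ω → Fin 2) (R : Ω → ℕ → ℝ) (D : Ω → ℕ → Fin 2 → ℕ → ℝ) : Prop where
  measurable_J : Measurable J
  prob_J_zero : P {ω | J ω = 0} = ENNReal.ofReal q
  prob_J_one : P {ω | J ω = 1} = ENNReal.ofReal (1 - q)
  measurable_R : Measurable R
  law_R : P.map R = poissonIntertimeLaw ξ
  measurable_D : ∀ n i, Measurable fun ω => D ω n i
  law_D : ∀ n i, P.map (fun ω => D ω n i) = gcpIntertimeLaw lam
  indep_clocks : iIndepFun (clocks R D) P
  indep_J : IndepFun J (fun ω c => clocks R D c ω) P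

/-! ### Densities -/

/-- The density `μ(dx) / dx` of a measure on the line at the point `x`: the lower limit of
`μ(I) / |I|` over the intervals `I = (x, y]` (for `y > x`) and `I = (y, x]` (for `y < x`)
as `y → x`. It is the derivative of the distribution function wherever that exists, and
the smaller one of the two one-sided derivatives where these differ. -/
def density (μ : Measure ℝ) (x : ℝ) : ℝ :=
  (liminf (fun y => μ (uIoc x y) / ENNReal.ofReal |y - x|) (𝓝[≠] x)).toReal

/-- The density at `x` of the position at time `t` of the motion with resets that has the
initial velocity index `j`. -/
def condPDF {Ω : Type*} [MeasurableSpace Ω] (P : Measure Ω) (v₁ v₂ : ℝ)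
    (R : Ω → ℕ → ℝ) (D : Ω → ℕ → Fin 2 → ℕ → ℝ) (j : Fin 2) (x t : ℝ) : ℝ :=
  density (P.map fun ω => resetPosition v₁ v₂ (R ω) (D ω) j t) x

/-- The density at `x` of the position at time `t` of the motion with resets and with
random initial velocity, which is `v₁` with probability `q` and `v₂` with probability `1 - q`. -/
def mixedPDF {Ω : Type*} [MeasurableSpace Ω] (P : Measure Ω) (v₁ v₂ q : ℝ)
    (R : Ω → ℕ → ℝ) (D : Ω → ℕ → Fin 2 → ℕ → ℝ) (x t : ℝ) : ℝ :=
  q * condPDF P v₁ v₂ R D 0 x t + (1 - q) * condPDF P v₁ v₂ R D 1 x t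

/-! ### The ingredients of the limit -/

/-- The generalized incomplete Gamma function `Γ(a, z₀, z₁)`. -/
def genIncGamma (a z₀ z₁ : ℝ) : ℝ := ∫ u in z₀..z₁, u ^ (a - 1) * Real.exp (-u)

/-- The upper incomplete Gamma function `Γ(a, z)`. -/
def upperIncGamma (a z : ℝ) : ℝ := ∫ u in Ioi z, u ^ (a - 1) * Real.exp (-u)

open Classical in
/-- The limiting reset term `H̄` for the velocity `v`. -/
def Hbar (lam ξ v x : ℝ) : ℝ :=
  if 0 < x / v then Real.sign v * (ξ * Real.exp (-ξ * (x / v)) / (v + lam * x)) else 0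

open Classical in
/-- The indicator of the event `x > 0`. -/
def posIndicator (x : ℝ) : ℝ := if 0 < x then 1 else 0

end ResetTelegraph

end

/-! The plan is to compute the law of the reset motion explicitly at each time and then let time
grow.

One run between resets. Mixing the Poisson weights over an exponential intensity gives geometric
weights: a GCP has exactly `n` epochs up to `t` with probability `(lam * t) ^ n / (1 + lam * t) ^ (n
+ 1)`. The position is an affine function of the time spent in the initial state (`evenTime`). That
time exceeds `u` exactly when the other clock has fewer than `t - u` units in its first `n`
intertimes, where `n` counts the epochs of the initial clock up to `u`
(`lt_evenTime_runDuration_iff`). By independence the probability of this is a geometric series with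
sum `(1 + lam * (t - u)) / (1 + lam * t)`, which is affine in `u`. So the occupation time has an
atom at `t` and is otherwise uniform on `(0, t)`, and the position has an atom at `v_j t` and is
otherwise uniform on `(v₂ t, v₁ t)` (`map_position_gcp_prod`).

Resets. The time since the last reset is an exponential variable of rate `ξ` truncated at `t`, so
the reset law is `exp (-ξ t)` times the law of a run of length `t`, plus the integral over `s ∈ [0,
t]` of `ξ exp (-ξ s)` times the law of a run of length `s` (`IsDriver.map_resetPosition_apply`).
Integrating over `s` smears the moving atom into the density `hitPDF` and the uniform parts into
`spreadPDF`; only the atom at `v_j t` survives.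

Pointwise values. The resulting density `resetPDF` is continuous off `0`, `v₁ t`, `v₂ t`. At `0` it
jumps because of `hitPDF`, but it takes the smaller one-sided limit there, which is what the lower
limit in `density` selects. Hence `density` equals `resetPDF` everywhere except at the two extremes
(`density_resetPDF`).

Limit. A fixed `x` is eventually different from both extremes. The term without resets decays,
`hitPDF` becomes constantly `Hbar`, and `spreadPDF` converges to an integral over the half-line,
which the substitution `u = ξ * (s + 1 / lam)` turns into an incomplete Gamma function
(`integral_spread_eq`). -/

noncomputable section

namespace ResetTelegraph

section

/-! ### Counting along a sequence of intertimes -/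

/-- The intertimes are positive and the epochs exhaust the half-line. -/
structure IsRegular (d : ℕ → ℝ) : Prop where
  pos : ∀ k, 0 < d k
  unbounded : ∀ x, ∃ n, x < epoch d n

@[simp] lemma epoch_zero (d : ℕ → ℝ) : epoch d 0 = 0 := by simp [epoch]

lemma epoch_succ (d : ℕ → ℝ) (n : ℕ) : epoch d (n + 1) = epoch d n + d n :=
  Finset.sum_range_succ _ _

lemma measurable_epoch (n : ℕ) : Measurable fun d : ℕ → ℝ => epoch d n := by
  unfold epoch; fun_prop

lemma IsRegular.strictMono_epoch {d : ℕ → ℝ} (h : IsRegular d) : StrictMono (epoch d) :=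
  strictMono_nat_of_lt_succ fun n => by rw [epoch_succ]; linarith [h.pos n]

lemma IsRegular.epoch_nonneg {d : ℕ → ℝ} (h : IsRegular d) (n : ℕ) : 0 ≤ epoch d n :=
  Finset.sum_nonneg fun k _ => (h.pos k).le

lemma IsRegular.countUpTo_eq {d : ℕ → ℝ} (h : IsRegular d) {t : ℝ} {n : ℕ}
    (h₁ : epoch d n ≤ t) (h₂ : t < epoch d (n + 1)) : countUpTo d t = n := by
  have : {m : ℕ | epoch d (m + 1) ≤ t} = (Finset.range n : Set ℕ) := by
    ext m
    simp only [mem_ofPred_eq, Finset.coe_range, mem_Iio]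
    constructor
    · intro hm
      have := h.strictMono_epoch.lt_iff_lt.1 (hm.trans_lt h₂)
      omega
    · intro hm
      exact (h.strictMono_epoch.monotone (by omega : m + 1 ≤ n)).trans h₁
  rw [countUpTo, this, ncard_coe_finset, Finset.card_range]

lemma IsRegular.exists_epoch_le_lt {d : ℕ → ℝ} (h : IsRegular d) {t : ℝ} (ht : 0 ≤ t) :
    ∃ n, epoch d n ≤ t ∧ t < epoch d (n + 1) := by
  classical
  have hex := h.unbounded t
  have hpos : Nat.find hex ≠ 0 := by
    intro h0
    have := Nat.find_spec hex
    rw [h0, epoch_zero] at this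
    linarith
  obtain ⟨n, hn⟩ := Nat.exists_eq_succ_of_ne_zero hpos
  refine ⟨n, ?_, ?_⟩
  · exact not_lt.1 (Nat.find_min hex (by omega))
  · have := Nat.find_spec hex
    rwa [hn] at this

/-! ### Measurability of counts, velocities and positions -/

lemma measurable_ncard_setOf {α : Type*} [MeasurableSpace α] {p : ℕ → α → Prop}
    (hp : ∀ n, MeasurableSet {a | p n a}) : Measurable fun a => {n : ℕ | p n a}.ncard := by
  -- A nonzero `ncard` forces the set to be finite, and there are only countably many finite sets of
  -- naturals. Level zero mixes the empty set with the infinite sets, so it is obtained as a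
  -- complement.
  have key : ∀ m : ℕ, m ≠ 0 → MeasurableSet ((fun a => {n : ℕ | p n a}.ncard) ⁻¹' {m}) := by
    intro m hm
    have : ((fun a => {n : ℕ | p n a}.ncard) ⁻¹' {m}) =
        ⋃ F : {F : Finset ℕ // F.card = m}, ⋂ n : ℕ, {a | p n a ↔ n ∈ F.1} := by
      ext a
      simp only [mem_preimage, mem_singleton_iff, mem_iUnion, mem_iInter, mem_ofPred_eq]
      constructor
      · intro h
        have hfin : {n : ℕ | p n a}.Finite := finite_of_ncard_ne_zero (by rw [h]; exact hm)
        exact ⟨⟨hfin.toFinset, by rw [← ncard_eq_toFinset_card _ hfin, h]⟩, fun n => by simp⟩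
      · rintro ⟨⟨F, hF⟩, h⟩
        have : {n : ℕ | p n a} = (F : Set ℕ) := by ext n; simp [h n]
        rw [this, ncard_coe_finset, hF]
    rw [this]
    refine MeasurableSet.iUnion fun F => MeasurableSet.iInter fun n => ?_
    by_cases hn : n ∈ F.1
    · simpa only [hn, iff_true] using hp n
    · simpa only [hn, iff_false] using! (hp n).compl
  refine measurable_to_countable' fun m => ?_
  rcases eq_or_ne m 0 with rfl | hm
  · have : ((fun a => {n : ℕ | p n a}.ncard) ⁻¹' {0}) =
        (⋃ m : {m : ℕ // m ≠ 0}, (fun a => {n : ℕ | p n a}.ncard) ⁻¹' {m.1})ᶜ := by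
      ext a
      simp only [mem_preimage, mem_singleton_iff, mem_compl_iff, mem_iUnion, Subtype.exists,
        exists_prop, exists_eq_right', not_not]
    rw [this]
    exact (MeasurableSet.iUnion fun m : {m : ℕ // m ≠ 0} => key m.1 m.2).compl
  · exact key m hm

lemma _root_.Measurable.countUpTo {α : Type*} [MeasurableSpace α] {f : α → ℕ → ℝ} {g : α → ℝ}
    (hf : Measurable f) (hg : Measurable g) : Measurable fun a => countUpTo (f a) (g a) := by
  unfold ResetTelegraph.countUpTo
  exact measurable_ncard_setOf (p := fun n a => epoch (f a) (n + 1) ≤ g a) fun n =>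
    measurableSet_le ((measurable_epoch (n + 1)).comp hf) hg

lemma measurable_runDuration (j : Fin 2) :
    Measurable fun D : Fin 2 → ℕ → ℝ => runDuration D j := by
  unfold runDuration; fun_prop

lemma _root_.Measurable.velocity {α : Type*} [MeasurableSpace α] (v₁ v₂ : ℝ) (j : Fin 2)
    {f : α → Fin 2 → ℕ → ℝ} {g : α → ℝ} (hf : Measurable f) (hg : Measurable g) :
    Measurable fun a => velocity v₁ v₂ (f a) j (g a) := by
  have h : Measurable fun a => countUpTo (runDuration (f a) j) (g a) :=
    ((measurable_runDuration j).comp hf).countUpTo hg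
  unfold ResetTelegraph.velocity
  exact measurable_const.add (measurable_const.mul
    ((measurable_from_top (f := fun n : ℕ => (-1 : ℝ) ^ n)).comp h))

lemma measurable_position (v₁ v₂ : ℝ) (j : Fin 2) :
    Measurable fun p : (Fin 2 → ℕ → ℝ) × ℝ => position v₁ v₂ p.1 j p.2 := by
  have key : ∀ f g : (Fin 2 → ℕ → ℝ) × ℝ → ℝ, Measurable f → Measurable g →
      Measurable fun p : (Fin 2 → ℕ → ℝ) × ℝ =>
        ∫ s in Ioc (f p) (g p), velocity v₁ v₂ p.1 j s := by
    intro f g hf hg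
    have h : ∀ p : (Fin 2 → ℕ → ℝ) × ℝ, ∫ s in Ioc (f p) (g p), velocity v₁ v₂ p.1 j s =
        ∫ s, {q : ((Fin 2 → ℕ → ℝ) × ℝ) × ℝ | q.2 ∈ Ioc (f q.1) (g q.1)}.indicator
          (fun q => velocity v₁ v₂ q.1.1 j q.2) (p, s) := by
      intro p
      rw [← integral_indicator measurableSet_Ioc]
      rfl
    simp_rw [h]
    refine StronglyMeasurable.measurable (StronglyMeasurable.integral_prod_right' ?_)
    refine Measurable.stronglyMeasurable (Measurable.indicator ?_ ?_)
    · exact Measurable.velocity v₁ v₂ j (measurable_fst.comp measurable_fst) measurable_snd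
    · exact (measurableSet_lt (hf.comp measurable_fst) measurable_snd).inter
        (measurableSet_le measurable_snd (hg.comp measurable_fst))
  unfold position intervalIntegral
  exact (key _ _ measurable_const measurable_snd).sub (key _ _ measurable_snd measurable_const)

/-- The clocks of the motion before they are assigned to a probability space. -/
abbrev ClockSpace : Type := Option (ℕ × Fin 2) → ℕ → ℝ

lemma _root_.Measurable.position {α : Type*} [MeasurableSpace α] (v₁ v₂ : ℝ) (j : Fin 2)
    {f : α → Fin 2 → ℕ → ℝ} {g : α → ℝ} (hf : Measurable f) (hg : Measurable g) :
    Measurable fun a => position v₁ v₂ (f a) j (g a) :=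
  (measurable_position v₁ v₂ j).comp (g := fun p : (Fin 2 → ℕ → ℝ) × ℝ =>
    ResetTelegraph.position v₁ v₂ p.1 j p.2) (f := fun a => (f a, g a)) (hf.prodMk hg)

lemma measurable_resetPosition (v₁ v₂ : ℝ) (j : Fin 2) (t : ℝ) :
    Measurable fun c : ClockSpace =>
      resetPosition v₁ v₂ (c none) (fun n i => c (some (n, i))) j t := by
  have hN : Measurable fun c : ClockSpace => countUpTo (c none) t :=
    (measurable_pi_apply none).countUpTo measurable_const
  have h : Measurable fun q : ClockSpace × ℕ =>
      position v₁ v₂ (fun i => q.1 (some (q.2, i))) j (t - epoch (q.1 none) q.2) := by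
    refine measurable_from_prod_countable_left fun n => ?_
    refine Measurable.position v₁ v₂ j (f := fun c : ClockSpace => fun i => c (some (n, i)))
      (g := fun c : ClockSpace => t - epoch (c none) n) ?_ ?_
    · exact measurable_pi_lambda _ fun i => measurable_pi_apply _
    · exact measurable_const.sub ((measurable_epoch n).comp (measurable_pi_apply none))
  unfold resetPosition
  exact h.comp (f := fun c : ClockSpace => (c, countUpTo (c none) t)) (measurable_id.prodMk hN)

/-! ### The time spent in the initial state -/

/-- The time up to `t` during which an even number of epochs has occurred. -/
def evenTime (d : ℕ → ℝ) (t : ℝ) : ℝ :=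
  ∫ s in (0 : ℝ)..t, if Even (countUpTo d s) then 1 else 0

lemma intervalIntegrable_evenIndicator (d : ℕ → ℝ) (a b : ℝ) :
    IntervalIntegrable (fun s => if Even (countUpTo d s) then (1 : ℝ) else 0) volume a b := by
  have hm : Measurable fun s => if Even (countUpTo d s) then (1 : ℝ) else 0 :=
    (measurable_from_top (f := fun n : ℕ => if Even n then (1 : ℝ) else 0)).comp
      (measurable_const.countUpTo measurable_id)
  refine (intervalIntegrable_const (c := (1 : ℝ))).mono_fun hm.aestronglyMeasurable ?_
  refine Eventually.of_forall fun s => ?_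
  dsimp only
  split_ifs <;> simp

/-- The velocity is `v₁` exactly while an even number of switches has occurred, so the law of the
position reduces to that of one occupation time. -/
lemma position_zero_eq (v₁ v₂ : ℝ) (D : Fin 2 → ℕ → ℝ) (t : ℝ) :
    position v₁ v₂ D 0 t = v₂ * t + (v₁ - v₂) * evenTime (runDuration D 0) t := by
  have : ∀ s, velocity v₁ v₂ D 0 s =
      v₂ + (v₁ - v₂) * (if Even (countUpTo (runDuration D 0) s) then 1 else 0) := by
    intro s
    unfold velocity
    split_ifs with h
    · rw [h.neg_one_pow]; simp; ring
    · rw [(Nat.not_even_iff_odd.1 h).neg_one_pow]; simp; ring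
  unfold position evenTime
  simp_rw [this]
  rw [intervalIntegral.integral_add intervalIntegrable_const
    ((intervalIntegrable_evenIndicator _ _ _).const_mul _), intervalIntegral.integral_const,
    intervalIntegral.integral_const_mul]
  simp [mul_comm]

lemma position_one_eq (v₁ v₂ : ℝ) (D : Fin 2 → ℕ → ℝ) (t : ℝ) :
    position v₁ v₂ D 1 t = position v₂ v₁ (fun i => D (1 - i)) 0 t := by
  have h : runDuration D 1 = runDuration (fun i => D (1 - i)) 0 := by
    funext k
    have : ∀ i : Fin 2, 1 + i = 1 - (0 + i) := by decide
    simp only [runDuration, this]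
  unfold position velocity
  rw [h]
  congr 1
  funext s
  simp
  ring

lemma evenTime_sub (d : ℕ → ℝ) (a b : ℝ) :
    evenTime d b - evenTime d a = ∫ s in a..b, if Even (countUpTo d s) then 1 else 0 :=
  intervalIntegral.integral_interval_sub_left (intervalIntegrable_evenIndicator _ _ _)
    (intervalIntegrable_evenIndicator _ _ _)

lemma evenTime_mono (d : ℕ → ℝ) : Monotone (evenTime d) := by
  intro a b hab
  have := evenTime_sub d a b
  have h0 : 0 ≤ ∫ s in a..b, if Even (countUpTo d s) then (1 : ℝ) else 0 :=
    intervalIntegral.integral_nonneg hab fun s _ => by split_ifs <;> simp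
  linarith

lemma evenTime_sub_le (d : ℕ → ℝ) {a b : ℝ} (hab : a ≤ b) :
    evenTime d b - evenTime d a ≤ b - a := by
  rw [evenTime_sub]
  calc _ ≤ ∫ _ in a..b, (1 : ℝ) :=
        intervalIntegral.integral_mono_on hab (intervalIntegrable_evenIndicator _ _ _)
          intervalIntegrable_const fun s _ => by split_ifs <;> simp
    _ = b - a := by simp

@[simp] lemma evenTime_zero (d : ℕ → ℝ) : evenTime d 0 = 0 := by simp [evenTime]

lemma IsRegular.evenTime_sub_of_mem {d : ℕ → ℝ} (h : IsRegular d) {n : ℕ} {a b : ℝ}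
    (ha : epoch d n ≤ a) (hab : a ≤ b) (hb : b ≤ epoch d (n + 1)) :
    evenTime d b - evenTime d a = if Even n then b - a else 0 := by
  rw [evenTime_sub]
  -- The count is constant only on the open interval: at `b` it may already have jumped, which does
  -- not affect the integral.
  have : ∫ s in a..b, (if Even (countUpTo d s) then (1 : ℝ) else 0) =
      ∫ s in a..b, (if Even n then (1 : ℝ) else 0) := by
    rw [intervalIntegral.integral_of_le hab, intervalIntegral.integral_of_le hab,
      integral_Ioc_eq_integral_Ioo, integral_Ioc_eq_integral_Ioo]
    refine setIntegral_congr_fun measurableSet_Ioo fun s hs => ?_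
    rw [h.countUpTo_eq (ha.trans hs.1.le) (hs.2.trans_le hb)]
  rw [this]
  split_ifs <;> simp

/-! ### Occupation time along alternating runs -/

lemma epoch_runDuration_two_mul (D : Fin 2 → ℕ → ℝ) (n : ℕ) :
    epoch (runDuration D 0) (2 * n) = epoch (D 0) n + epoch (D 1) n ∧
    epoch (runDuration D 0) (2 * n + 1) = epoch (D 0) (n + 1) + epoch (D 1) n := by
  have h0 : ∀ n, runDuration D 0 (2 * n) = D 0 n := fun n => by
    have : Fin.ofNat 2 (2 * n) = 0 := by ext; simp
    rw [runDuration, this]; simp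
  have h1 : ∀ n, runDuration D 0 (2 * n + 1) = D 1 n := fun n => by
    have : Fin.ofNat 2 (2 * n + 1) = 1 := by ext; simp [Fin.ofNat]
    have h2 : (2 * n + 1) / 2 = n := by omega
    rw [runDuration, this, h2]; simp
  induction n with
  | zero => simp [epoch_succ, h0 0]
  | succ n ih =>
    have e : epoch (runDuration D 0) (2 * (n + 1)) = epoch (D 0) (n + 1) + epoch (D 1) (n + 1) := by
      rw [show 2 * (n + 1) = 2 * n + 1 + 1 by ring, epoch_succ, ih.2, h1, epoch_succ (D 1)]
      ring
    refine ⟨e, ?_⟩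
    rw [epoch_succ, e, h0, epoch_succ (D 0) (n + 1)]
    ring

lemma isRegular_runDuration {D : Fin 2 → ℕ → ℝ} (h₀ : IsRegular (D 0)) (h₁ : IsRegular (D 1)) :
    IsRegular (runDuration D 0) where
  pos k := by
    unfold runDuration
    generalize (0 : Fin 2) + Fin.ofNat 2 k = i
    fin_cases i
    · exact h₀.pos _
    · exact h₁.pos _
  unbounded x := by
    obtain ⟨n, hn⟩ := h₀.unbounded x
    refine ⟨2 * n, ?_⟩
    rw [(epoch_runDuration_two_mul D n).1]
    linarith [h₁.epoch_nonneg n]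

lemma evenTime_runDuration {D : Fin 2 → ℕ → ℝ} (h₀ : IsRegular (D 0)) (h₁ : IsRegular (D 1))
    {n : ℕ} {s : ℝ} (hs : epoch (D 0) n + epoch (D 1) n ≤ s)
    (hs' : s ≤ epoch (D 0) (n + 1) + epoch (D 1) n) :
    evenTime (runDuration D 0) s = s - epoch (D 1) n := by
  have hr := isRegular_runDuration h₀ h₁
  have step : ∀ m s, epoch (D 0) m + epoch (D 1) m ≤ s → s ≤ epoch (D 0) (m + 1) + epoch (D 1) m →
      evenTime (runDuration D 0) s - evenTime (runDuration D 0) (epoch (D 0) m + epoch (D 1) m) =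
        s - (epoch (D 0) m + epoch (D 1) m) := by
    intro m s hs hs'
    have := hr.evenTime_sub_of_mem (n := 2 * m) (a := epoch (D 0) m + epoch (D 1) m) (b := s)
      (epoch_runDuration_two_mul D m).1.le hs (hs'.trans (epoch_runDuration_two_mul D m).2.ge)
    simpa using this
  have base : ∀ m, evenTime (runDuration D 0) (epoch (D 0) m + epoch (D 1) m) = epoch (D 0) m := by
    intro m
    induction m with
    | zero => simp
    | succ m ih =>
      have p0 := h₀.pos m
      have p1 := h₁.pos m
      have e1 := step m (epoch (D 0) (m + 1) + epoch (D 1) m) (by rw [epoch_succ]; linarith) le_rfl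
      have e2 := hr.evenTime_sub_of_mem (n := 2 * m + 1)
        (a := epoch (D 0) (m + 1) + epoch (D 1) m) (b := epoch (D 0) (m + 1) + epoch (D 1) (m + 1))
        (epoch_runDuration_two_mul D m).2.le (by rw [epoch_succ (D 1)]; linarith)
        (epoch_runDuration_two_mul D (m + 1)).1.ge
      rw [if_neg (by simp)] at e2
      linarith
  linarith [step n s hs hs', base n]

/-- When the occupation time is about to exceed `u`, the initial clock has used `n` full intertimes,
so `n` complete stays in the other state lie behind. The motion leaves the level `u` of occupation
exactly at time `u + epoch (D 1) n`. -/
lemma lt_evenTime_runDuration_iff {D : Fin 2 → ℕ → ℝ} (h₀ : IsRegular (D 0))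
    (h₁ : IsRegular (D 1)) {n : ℕ} {u t : ℝ} (hu : epoch (D 0) n ≤ u)
    (hu' : u < epoch (D 0) (n + 1)) :
    u < evenTime (runDuration D 0) t ↔ epoch (D 1) n < t - u := by
  have e : evenTime (runDuration D 0) (u + epoch (D 1) n) = u := by
    rw [evenTime_runDuration h₀ h₁ (n := n) (by linarith) (by linarith)]
    ring
  constructor
  · intro h
    by_contra hle
    have := evenTime_mono (runDuration D 0) (by linarith : t ≤ u + epoch (D 1) n)
    linarith
  · intro h
    -- Occupation grows at unit rate until the current run ends, so `t` is cut off at that end;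
    -- monotonicity covers the rest.
    set s := min t (epoch (D 0) (n + 1) + epoch (D 1) n)
    have hs : u + epoch (D 1) n < s := lt_min (by linarith) (by linarith)
    have := evenTime_runDuration h₀ h₁ (n := n) (s := s) (by linarith) (min_le_right _ _)
    have := evenTime_mono (runDuration D 0) (min_le_left t (epoch (D 0) (n + 1) + epoch (D 1) n))
    linarith

lemma evenTime_nonneg (d : ℕ → ℝ) {t : ℝ} (ht : 0 ≤ t) : 0 ≤ evenTime d t := by
  simpa using evenTime_mono d ht

lemma evenTime_le (d : ℕ → ℝ) {t : ℝ} (ht : 0 ≤ t) : evenTime d t ≤ t := by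
  simpa using evenTime_sub_le d ht

end

section

/-! ### Poisson processes -/

/-- The density of the `(n + 1)`-st epoch of a Poisson process with intensity `r`. -/
def erlangPDF (r : ℝ) (n : ℕ) (x : ℝ) : ℝ≥0∞ :=
  (Ici 0).indicator
    (fun x => ENNReal.ofReal (r ^ (n + 1) * x ^ n / n.factorial * Real.exp (-(r * x)))) x

lemma measurable_erlangPDF (r : ℝ) (n : ℕ) : Measurable (erlangPDF r n) := by
  unfold erlangPDF
  exact Measurable.indicator (by fun_prop) measurableSet_Ici

lemma expMeasure_eq_withDensity_erlangPDF (r : ℝ) :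
    expMeasure r = volume.withDensity (erlangPDF r 0) := by
  have : erlangPDF r 0 = exponentialPDF r := by
    funext x
    rw [exponentialPDF_eq, erlangPDF, indicator_apply]
    simp only [mem_Ici]
    split_ifs <;> simp
  rw [this]
  rfl

/-- The exponential factors combine to `exp (-(r * x))`, independent of `y`, which leaves the
integral of `y ^ n` over `[0, x]`. -/
lemma erlangPDF_conv {r : ℝ} (hr : 0 < r) (n : ℕ) :
    lconvolution (erlangPDF r n) (erlangPDF r 0) volume = erlangPDF r (n + 1) := by
  funext x
  rw [lconvolution_def]
  have h : ∀ y, erlangPDF r n y * erlangPDF r 0 (-y + x) = (Icc 0 x).indicator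
      (fun y => ENNReal.ofReal (r ^ (n + 2) / n.factorial * Real.exp (-(r * x)) * y ^ n)) y := by
    intro y
    simp only [erlangPDF, indicator_apply, mem_Ici, mem_Icc]
    by_cases h0 : 0 ≤ y
    · by_cases h1 : y ≤ x
      · rw [if_pos h0, if_pos (by linarith), if_pos ⟨h0, h1⟩,
          ← ENNReal.ofReal_mul (by positivity)]
        congr 1
        have : Real.exp (-(r * x)) = Real.exp (-(r * y)) * Real.exp (-(r * (-y + x))) := by
          rw [← Real.exp_add]; ring_nf
        rw [this]
        simp
        ring
      · rw [if_neg (by linarith : ¬ 0 ≤ -y + x),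
          if_neg (fun h => h1 h.2 : ¬ (0 ≤ y ∧ y ≤ x)), mul_zero]
    · simp [h0]
  simp_rw [h]
  rw [lintegral_indicator measurableSet_Icc]
  rcases lt_or_ge x 0 with hx | hx
  · simp [erlangPDF, hx]
  · rw [← ofReal_integral_eq_lintegral_ofReal]
    · rw [integral_Icc_eq_integral_Ioc, ← intervalIntegral.integral_of_le hx,
        intervalIntegral.integral_const_mul, integral_pow, erlangPDF, indicator_of_mem (by exact hx)]
      congr 1
      rw [Nat.factorial_succ]
      push_cast
      field_simp
      ring
    · exact Continuous.integrableOn_Icc (by fun_prop)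
    · refine (ae_restrict_mem measurableSet_Icc).mono fun y hy => ?_
      have := hy.1
      positivity

variable {r : ℝ}

lemma isProbabilityMeasure_poissonIntertimeLaw (hr : 0 < r) :
    IsProbabilityMeasure (poissonIntertimeLaw r) := by
  have := isProbabilityMeasure_expMeasure hr
  unfold poissonIntertimeLaw
  infer_instance

lemma map_eval_poissonIntertimeLaw (hr : 0 < r) (k : ℕ) :
    (poissonIntertimeLaw r).map (fun d => d k) = expMeasure r := by
  have := isProbabilityMeasure_expMeasure hr
  exact Measure.infinitePi_map_eval (fun _ : ℕ => expMeasure r) k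

lemma indepFun_epoch_eval (hr : 0 < r) (n : ℕ) :
    IndepFun (fun d : ℕ → ℝ => epoch d n) (fun d => d n) (poissonIntertimeLaw r) := by
  have := isProbabilityMeasure_expMeasure hr
  have h : iIndepFun (fun (i : ℕ) (d : ℕ → ℝ) => d i) (poissonIntertimeLaw r) :=
    iIndepFun_infinitePi (P := fun _ : ℕ => expMeasure r) (X := fun _ x => x)
      fun _ => measurable_id
  have h2 := h.indepFun_finsetSum_of_notMem (fun i => measurable_pi_apply i)
    (s := Finset.range n) (i := n) (by simp)
  convert h2 using 1
  funext d
  simp [epoch]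

lemma map_epoch_prod_poissonIntertimeLaw (hr : 0 < r) (n : ℕ) :
    (poissonIntertimeLaw r).map (fun d => (epoch d n, d n)) =
      ((poissonIntertimeLaw r).map fun d => epoch d n).prod (expMeasure r) := by
  have := isProbabilityMeasure_poissonIntertimeLaw hr
  rw [← map_eval_poissonIntertimeLaw hr n]
  exact (indepFun_iff_map_prod_eq_prod_map_map (measurable_epoch n).aemeasurable
    (measurable_pi_apply n).aemeasurable).1 (indepFun_epoch_eval hr n)

lemma map_epoch_poissonIntertimeLaw (hr : 0 < r) (n : ℕ) :
    (poissonIntertimeLaw r).map (fun d => epoch d (n + 1)) =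
      volume.withDensity (erlangPDF r n) := by
  have := isProbabilityMeasure_poissonIntertimeLaw hr
  induction n with
  | zero =>
    rw [← expMeasure_eq_withDensity_erlangPDF, ← map_eval_poissonIntertimeLaw hr 0]
    congr 1
    funext d
    simp [epoch_succ]
  | succ n ih =>
    have h : (fun d : ℕ → ℝ => epoch d (n + 1 + 1)) =
        (fun d => epoch d (n + 1)) + fun d => d (n + 1) := by
      funext d
      rw [epoch_succ]
      rfl
    rw [h, (indepFun_epoch_eval hr (n + 1)).map_add_eq_map_conv_map₀
      (measurable_epoch _).aemeasurable (measurable_pi_apply _).aemeasurable, ih,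
      map_eval_poissonIntertimeLaw hr, expMeasure_eq_withDensity_erlangPDF,
      conv_withDensity_eq_lconvolution (measurable_erlangPDF _ _) (measurable_erlangPDF _ _),
      erlangPDF_conv hr]

lemma lintegral_erlangPDF (hr : 0 < r) (n : ℕ) : ∫⁻ x, erlangPDF r n x = 1 := by
  have := isProbabilityMeasure_poissonIntertimeLaw hr
  have h := congrArg (fun m => m univ) (map_epoch_poissonIntertimeLaw hr n)
  simp only [withDensity_apply _ MeasurableSet.univ, Measure.restrict_univ] at h
  rw [← h, Measure.map_apply (measurable_epoch _) MeasurableSet.univ]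
  simp

lemma expMeasure_Ioi (hr : 0 < r) {x : ℝ} (hx : 0 ≤ x) :
    expMeasure r (Ioi x) = ENNReal.ofReal (Real.exp (-(r * x))) := by
  have := isProbabilityMeasure_expMeasure hr
  have h := cdf_expMeasure_eq hr x
  rw [if_pos hx, cdf_eq_real] at h
  have h2 : (expMeasure r).real (Ioi x) = Real.exp (-(r * x)) := by
    rw [← compl_Iic, probReal_compl_eq_one_sub measurableSet_Iic, h]
    ring
  rw [← h2, ofReal_measureReal]

lemma ae_pos_expMeasure (hr : 0 < r) : ∀ᵐ x ∂expMeasure r, 0 < x := by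
  have := isProbabilityMeasure_expMeasure hr
  have h := expMeasure_Ioi hr le_rfl
  simp only [mul_zero, neg_zero, Real.exp_zero, ENNReal.ofReal_one] at h
  exact (prob_compl_eq_zero_iff measurableSet_Ioi).2 h

lemma measurableSet_between_epochs (n : ℕ) (t : ℝ) :
    MeasurableSet {d : ℕ → ℝ | epoch d n ≤ t ∧ t < epoch d (n + 1)} :=
  (measurableSet_le (measurable_epoch n) measurable_const).inter
    (measurableSet_lt measurable_const (measurable_epoch (n + 1)))

/-- Just after the `n`-th epoch, the time until the next one is exponential. -/
lemma lintegral_between_epochs (hr : 0 < r) (n : ℕ) (t : ℝ) {φ : ℝ → ℝ≥0∞} (hφ : Measurable φ) :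
    ∫⁻ d in {d | epoch d n ≤ t ∧ t < epoch d (n + 1)}, φ (epoch d n) ∂poissonIntertimeLaw r =
      ∫⁻ s in Iic t, φ s * ENNReal.ofReal (Real.exp (-(r * (t - s))))
        ∂(poissonIntertimeLaw r).map (fun d => epoch d n) := by
  have := isProbabilityMeasure_poissonIntertimeLaw hr
  have := isProbabilityMeasure_expMeasure hr
  have hT : MeasurableSet {p : ℝ × ℝ | p.1 ≤ t ∧ t < p.1 + p.2} :=
    (measurableSet_le measurable_fst measurable_const).inter
      (measurableSet_lt measurable_const (measurable_fst.add measurable_snd))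
  have hF : Measurable ({p : ℝ × ℝ | p.1 ≤ t ∧ t < p.1 + p.2}.indicator fun p => φ p.1) :=
    (hφ.comp measurable_fst).indicator hT
  calc _ = ∫⁻ d, {p : ℝ × ℝ | p.1 ≤ t ∧ t < p.1 + p.2}.indicator (fun p => φ p.1)
        (epoch d n, d n) ∂poissonIntertimeLaw r := by
        rw [← lintegral_indicator (measurableSet_between_epochs n t)]
        simp only [indicator_apply, mem_ofPred_eq, epoch_succ]
    _ = ∫⁻ p, {p : ℝ × ℝ | p.1 ≤ t ∧ t < p.1 + p.2}.indicator (fun p => φ p.1) p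
        ∂((poissonIntertimeLaw r).map fun d => epoch d n).prod (expMeasure r) := by
        rw [← map_epoch_prod_poissonIntertimeLaw hr,
          lintegral_map hF ((measurable_epoch n).prodMk (measurable_pi_apply n))]
    _ = _ := by
        rw [lintegral_prod _ hF.aemeasurable, ← lintegral_indicator measurableSet_Iic]
        refine lintegral_congr fun s => ?_
        by_cases hs : s ≤ t
        · rw [indicator_of_mem (by exact hs), ← expMeasure_Ioi hr (by linarith),
            ← lintegral_indicator_const measurableSet_Ioi]
          refine lintegral_congr fun x => ?_
          simp only [indicator_apply, mem_ofPred_eq, mem_Ioi, hs, true_and, sub_lt_iff_lt_add']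
        · rw [indicator_of_notMem (by exact hs)]
          simp [hs]

lemma lintegral_between_epochs_zero (hr : 0 < r) {t : ℝ} (ht : 0 ≤ t) {φ : ℝ → ℝ≥0∞}
    (hφ : Measurable φ) :
    ∫⁻ d in {d | epoch d 0 ≤ t ∧ t < epoch d (0 + 1)}, φ (epoch d 0) ∂poissonIntertimeLaw r =
      φ 0 * ENNReal.ofReal (Real.exp (-(r * t))) := by
  have := isProbabilityMeasure_poissonIntertimeLaw hr
  have h : (poissonIntertimeLaw r).map (fun d => epoch d 0) = Measure.dirac 0 := by
    simp [Measure.map_const]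
  rw [lintegral_between_epochs hr 0 t hφ, h, ← lintegral_indicator measurableSet_Iic,
    lintegral_dirac' _ (Measurable.indicator (by fun_prop) measurableSet_Iic),
    indicator_of_mem (by exact ht), sub_zero]

lemma lintegral_between_epochs_succ (hr : 0 < r) (n : ℕ) (t : ℝ) {φ : ℝ → ℝ≥0∞}
    (hφ : Measurable φ) :
    ∫⁻ d in {d | epoch d (n + 1) ≤ t ∧ t < epoch d (n + 1 + 1)}, φ (epoch d (n + 1))
        ∂poissonIntertimeLaw r =
      ∫⁻ s in Icc 0 t, φ s * ENNReal.ofReal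
        (r * Real.exp (-(r * t)) * ((r * s) ^ n / n.factorial)) := by
  rw [lintegral_between_epochs hr (n + 1) t hφ, map_epoch_poissonIntertimeLaw hr,
    setLIntegral_withDensity_eq_setLIntegral_mul _ (measurable_erlangPDF r n) (by fun_prop)
      measurableSet_Iic, ← lintegral_indicator measurableSet_Iic,
    ← lintegral_indicator measurableSet_Icc]
  refine lintegral_congr fun s => ?_
  simp only [indicator_apply, mem_Iic, mem_Icc, Pi.mul_apply, erlangPDF, mem_Ici]
  by_cases h0 : 0 ≤ s
  · by_cases h1 : s ≤ t
    · simp only [h0, h1, if_true, and_self]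
      rw [mul_left_comm, ← ENNReal.ofReal_mul (by positivity)]
      congr 2
      have : Real.exp (-(r * t)) = Real.exp (-(r * s)) * Real.exp (-(r * (t - s))) := by
        rw [← Real.exp_add]; ring_nf
      rw [this]
      ring
    · simp [h1]
  · simp [h0]

lemma poissonIntertimeLaw_between_epochs (hr : 0 < r) (n : ℕ) {t : ℝ} (ht : 0 ≤ t) :
    poissonIntertimeLaw r {d | epoch d n ≤ t ∧ t < epoch d (n + 1)} =
      ENNReal.ofReal ((r * t) ^ n / n.factorial * Real.exp (-(r * t))) := by
  rw [← setLIntegral_one]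
  cases n with
  | zero =>
    refine (lintegral_between_epochs_zero (φ := fun _ => 1) hr ht measurable_const).trans ?_
    simp
  | succ n =>
    refine (lintegral_between_epochs_succ (φ := fun _ => 1) hr n t measurable_const).trans ?_
    simp only [one_mul]
    rw [← ofReal_integral_eq_lintegral_ofReal]
    · rw [integral_Icc_eq_integral_Ioc, ← intervalIntegral.integral_of_le ht]
      congr 1
      have h : ∀ s, r * Real.exp (-(r * t)) * ((r * s) ^ n / n.factorial) =
          r * Real.exp (-(r * t)) * (r ^ n / n.factorial) * s ^ n := fun s => by
        rw [mul_pow]; ring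
      simp_rw [h]
      rw [intervalIntegral.integral_const_mul, integral_pow, Nat.factorial_succ]
      push_cast
      field_simp
      ring
    · exact Continuous.integrableOn_Icc (by fun_prop)
    · refine (ae_restrict_mem measurableSet_Icc).mono fun y hy => ?_
      have := hy.1
      positivity

lemma ae_pos_poissonIntertimeLaw (hr : 0 < r) :
    ∀ᵐ d ∂poissonIntertimeLaw r, ∀ k, 0 < d k := by
  rw [ae_all_iff]
  intro k
  have h := ae_pos_expMeasure hr
  rw [← map_eval_poissonIntertimeLaw hr k] at h
  exact ae_of_ae_map (measurable_pi_apply k).aemeasurable h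

/-- The Poisson weights sum to one, so almost surely every natural number lies between two
consecutive epochs. This rules out accumulation of epochs. -/
lemma ae_isRegular_poissonIntertimeLaw (hr : 0 < r) :
    ∀ᵐ d ∂poissonIntertimeLaw r, IsRegular d := by
  have := isProbabilityMeasure_poissonIntertimeLaw hr
  have key : ∀ m : ℕ, ∀ᵐ d ∂poissonIntertimeLaw r, ∃ n, (m : ℝ) < epoch d n := by
    intro m
    set S : ℕ → Set (ℕ → ℝ) := fun n => {d | epoch d n ≤ m ∧ m < epoch d (n + 1)} with hSdef
    have hU : poissonIntertimeLaw r (⋃ n, S n) = 1 := by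
      have hd : poissonIntertimeLaw r (⋃ n, S n) = ∑' n, poissonIntertimeLaw r (S n) := by
        refine measure_iUnion₀ ?_ fun n => (measurableSet_between_epochs n _).nullMeasurableSet
        intro i j hij
        rw [Function.onFun, AEDisjoint]
        refine measure_mono_null (t := {d | ¬ ∀ k, 0 < d k}) ?_ (ae_pos_poissonIntertimeLaw hr)
        rintro d ⟨hi, hj⟩ hpos
        have hmono : StrictMono (epoch d) :=
          strictMono_nat_of_lt_succ fun n => by rw [epoch_succ]; linarith [hpos n]
        have h1 := hmono.lt_iff_lt.1 (hi.1.trans_lt hj.2)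
        have h2 := hmono.lt_iff_lt.1 (hj.1.trans_lt hi.2)
        omega
      rw [hd]
      simp_rw [hSdef, poissonIntertimeLaw_between_epochs hr _ (Nat.cast_nonneg m)]
      have hsum : HasSum (fun n : ℕ => (r * m) ^ n / n.factorial * Real.exp (-(r * m))) 1 := by
        have := (NormedSpace.expSeries_div_hasSum_exp (r * m)).mul_right (Real.exp (-(r * m)))
        rwa [← Real.exp_eq_exp_ℝ, ← Real.exp_add, add_neg_cancel, Real.exp_zero] at this
      rw [← ENNReal.ofReal_tsum_of_nonneg (fun n => by positivity) hsum.summable, hsum.tsum_eq,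
        ENNReal.ofReal_one]
    have hc := (prob_compl_eq_zero_iff
      (MeasurableSet.iUnion fun n => measurableSet_between_epochs n _)).2 hU
    filter_upwards [compl_mem_ae_iff.2 hc] with d hd
    rw [compl_compl, mem_iUnion] at hd
    obtain ⟨n, hn⟩ := hd
    exact ⟨n + 1, hn.2⟩
  filter_upwards [ae_pos_poissonIntertimeLaw hr, ae_all_iff.2 key] with d h1 h2
  refine ⟨h1, fun x => ?_⟩
  obtain ⟨m, hm⟩ := exists_nat_gt x
  obtain ⟨n, hn⟩ := h2 m
  exact ⟨n, hm.trans hn⟩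

end

section

/-! ### Geometric counting processes -/

variable {lam : ℝ}

lemma measurable_div_intertimes :
    Measurable fun (p : ℝ × (ℕ → ℝ)) (k : ℕ) => p.2 k / p.1 :=
  measurable_pi_lambda _ fun k => ((measurable_pi_apply k).comp measurable_snd).div measurable_fst

lemma isProbabilityMeasure_gcpIntertimeLaw (hlam : 0 < lam) :
    IsProbabilityMeasure (gcpIntertimeLaw lam) := by
  have := isProbabilityMeasure_expMeasure (one_div_pos.2 hlam)
  have := isProbabilityMeasure_poissonIntertimeLaw one_pos
  exact Measure.isProbabilityMeasure_map measurable_div_intertimes.aemeasurable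

lemma epoch_div (d : ℕ → ℝ) (a : ℝ) (n : ℕ) : epoch (fun k => d k / a) n = epoch d n / a :=
  (Finset.sum_div _ _ _).symm

lemma measurableSet_isRegular : MeasurableSet {d : ℕ → ℝ | IsRegular d} := by
  have : {d : ℕ → ℝ | IsRegular d} =
      (⋂ k, {d | 0 < d k}) ∩ ⋂ m : ℕ, ⋃ n, {d | (m : ℝ) < epoch d n} := by
    ext d
    simp only [mem_ofPred_eq, mem_inter_iff, mem_iInter, mem_iUnion]
    refine ⟨fun h => ⟨h.pos, fun m => h.unbounded m⟩, fun h => ⟨h.1, fun x => ?_⟩⟩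
    obtain ⟨m, hm⟩ := exists_nat_gt x
    obtain ⟨n, hn⟩ := h.2 m
    exact ⟨n, hm.trans hn⟩
  rw [this]
  exact (MeasurableSet.iInter fun k =>
    measurableSet_lt measurable_const (measurable_pi_apply k)).inter
    (MeasurableSet.iInter fun m => MeasurableSet.iUnion fun n =>
      measurableSet_lt measurable_const (measurable_epoch n))

lemma ae_isRegular_gcpIntertimeLaw (hlam : 0 < lam) :
    ∀ᵐ d ∂gcpIntertimeLaw lam, IsRegular d := by
  have := isProbabilityMeasure_expMeasure (one_div_pos.2 hlam)
  have := isProbabilityMeasure_poissonIntertimeLaw one_pos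
  refine (ae_map_iff measurable_div_intertimes.aemeasurable measurableSet_isRegular).2 ?_
  filter_upwards [Measure.quasiMeasurePreserving_fst.ae (ae_pos_expMeasure (one_div_pos.2 hlam)),
    Measure.quasiMeasurePreserving_snd.ae (ae_isRegular_poissonIntertimeLaw one_pos)] with p h1 h2
  refine ⟨fun k => div_pos (h2.pos k) h1, fun x => ?_⟩
  obtain ⟨n, hn⟩ := h2.unbounded (x * p.1)
  exact ⟨n, by rwa [epoch_div, lt_div_iff₀ h1]⟩

lemma gcpIntertimeLaw_apply (hlam : 0 < lam) {S : Set (ℕ → ℝ)} (hS : MeasurableSet S) :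
    gcpIntertimeLaw lam S =
      ∫⁻ a, poissonIntertimeLaw 1 {d | (fun k => d k / a) ∈ S} ∂expMeasure (1 / lam) := by
  have := isProbabilityMeasure_expMeasure (one_div_pos.2 hlam)
  have := isProbabilityMeasure_poissonIntertimeLaw one_pos
  unfold gcpIntertimeLaw
  rw [Measure.map_apply measurable_div_intertimes hS,
    Measure.prod_apply (measurable_div_intertimes hS)]
  rfl

/-- Given the intensity `a`, the count is Poisson with mean `a * t`; the geometric weights come from
averaging over `a`. -/
lemma gcpIntertimeLaw_between_epochs (hlam : 0 < lam) (n : ℕ) {t : ℝ} (ht : 0 ≤ t) :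
    gcpIntertimeLaw lam {d | epoch d n ≤ t ∧ t < epoch d (n + 1)} =
      ENNReal.ofReal ((lam * t) ^ n / (1 + lam * t) ^ (n + 1)) := by
  rw [gcpIntertimeLaw_apply hlam (measurableSet_between_epochs n t)]
  have h1 : ∀ᵐ a ∂expMeasure (1 / lam),
      poissonIntertimeLaw 1 {d | (fun k => d k / a) ∈
        {d : ℕ → ℝ | epoch d n ≤ t ∧ t < epoch d (n + 1)}} =
      ENNReal.ofReal ((a * t) ^ n / n.factorial * Real.exp (-(a * t))) := by
    filter_upwards [ae_pos_expMeasure (one_div_pos.2 hlam)] with a ha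
    have := poissonIntertimeLaw_between_epochs one_pos n (t := a * t) (by positivity)
    rw [one_mul] at this
    rw [← this]
    congr 1
    ext d
    simp only [mem_ofPred_eq, epoch_div, div_le_iff₀ ha, lt_div_iff₀ ha, mul_comm t a]
  have hr : 0 < 1 / lam + t := by positivity
  -- As a function of `a`, exponential density times Poisson weight is a multiple of an Erlang
  -- density of rate `1 / lam + t`, so its integral is just the multiple.
  have h2 : ∀ a, erlangPDF (1 / lam) 0 a *
      ENNReal.ofReal ((a * t) ^ n / n.factorial * Real.exp (-(a * t))) =
      ENNReal.ofReal ((lam * t) ^ n / (1 + lam * t) ^ (n + 1)) *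
        erlangPDF (1 / lam + t) n a := by
    intro a
    simp only [erlangPDF, indicator_apply, mem_Ici]
    by_cases ha : 0 ≤ a
    · simp only [ha, if_true]
      rw [← ENNReal.ofReal_mul (by positivity), ← ENNReal.ofReal_mul (by positivity)]
      congr 1
      have e : Real.exp (-((1 / lam + t) * a)) =
          Real.exp (-(1 / lam * a)) * Real.exp (-(a * t)) := by
        rw [← Real.exp_add]; ring_nf
      have e2 : 1 / lam + t = (1 + lam * t) / lam := by field_simp
      rw [e, e2, div_pow, mul_pow, mul_pow, div_pow]
      have : 1 + lam * t ≠ 0 := by positivity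
      simp
      field_simp
      ring
    · simp [ha]
  rw [lintegral_congr_ae h1, expMeasure_eq_withDensity_erlangPDF,
    lintegral_withDensity_eq_lintegral_mul _ (measurable_erlangPDF _ _) (by fun_prop)]
  simp only [Pi.mul_apply, h2]
  rw [lintegral_const_mul _ (measurable_erlangPDF _ _), lintegral_erlangPDF hr, mul_one]

lemma gcpIntertimeLaw_epoch_eq (hlam : 0 < lam) (n : ℕ) {t : ℝ} (ht : 0 < t) :
    gcpIntertimeLaw lam {d | epoch d n = t} = 0 := by
  cases n with
  | zero => simp [ht.ne]
  | succ n =>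
    rw [gcpIntertimeLaw_apply hlam (measurableSet_eq_fun (measurable_epoch _) measurable_const)]
    refine (lintegral_congr_ae (g := 0) ?_).trans (by simp)
    filter_upwards [ae_pos_expMeasure (one_div_pos.2 hlam)] with a ha
    have h : {d : ℕ → ℝ | (fun k => d k / a) ∈ {d : ℕ → ℝ | epoch d (n + 1) = t}} =
        (fun d => epoch d (n + 1)) ⁻¹' {t * a} := by
      ext d
      simp only [mem_ofPred_eq, epoch_div, div_eq_iff ha.ne', mem_preimage, mem_singleton_iff]
    refine (congrArg _ h).trans ?_
    rw [← Measure.map_apply (measurable_epoch _) (measurableSet_singleton _),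
      map_epoch_poissonIntertimeLaw one_pos]
    exact withDensity_absolutelyContinuous _ _ (measure_singleton _)

/-- Induction on `n`: passing to the next epoch removes the probability of exactly `n` epochs. The
induction runs with `≤`; epochs have no atom at `t > 0`, so `<` gives the same value. -/
lemma gcpIntertimeLaw_epoch_lt (hlam : 0 < lam) (n : ℕ) {t : ℝ} (ht : 0 < t) :
    gcpIntertimeLaw lam {d | epoch d n < t} =
      ENNReal.ofReal ((lam * t / (1 + lam * t)) ^ n) := by
  have := isProbabilityMeasure_gcpIntertimeLaw hlam
  have hpos : 0 < 1 + lam * t := by positivity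
  have hle : (gcpIntertimeLaw lam).real {d | epoch d n ≤ t} = (lam * t / (1 + lam * t)) ^ n := by
    induction n with
    | zero => simp [ht.le]
    | succ n ih =>
      have hb : (gcpIntertimeLaw lam).real {d | epoch d n ≤ t ∧ t < epoch d (n + 1)} =
          (lam * t) ^ n / (1 + lam * t) ^ (n + 1) := by
        rw [Measure.real, gcpIntertimeLaw_between_epochs hlam n ht.le,
          ENNReal.toReal_ofReal (by positivity)]
      have hu : (gcpIntertimeLaw lam).real {d | epoch d n ≤ t} =
          (gcpIntertimeLaw lam).real {d | epoch d (n + 1) ≤ t} +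
          (gcpIntertimeLaw lam).real {d | epoch d n ≤ t ∧ t < epoch d (n + 1)} := by
        rw [← measureReal_union ?_ (measurableSet_between_epochs n t)]
        · refine measureReal_congr ?_
          filter_upwards [ae_isRegular_gcpIntertimeLaw hlam] with d hd
          refine propext ?_
          have := hd.strictMono_epoch (Nat.lt_succ_self n)
          change epoch d n ≤ t ↔ epoch d (n + 1) ≤ t ∨ (epoch d n ≤ t ∧ t < epoch d (n + 1))
          constructor
          · intro h
            rcases le_or_gt (epoch d (n + 1)) t with h' | h'
            · exact Or.inl h'
            · exact Or.inr ⟨h, h'⟩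
          · rintro (h | h)
            · exact this.le.trans h
            · exact h.1
        · rw [Set.disjoint_left]
          intro d h h'
          exact absurd h'.2 (not_lt.2 h)
      rw [ih, hb] at hu
      rw [eq_sub_of_add_eq hu.symm, div_pow, div_pow]
      field_simp
      ring
  have h : (gcpIntertimeLaw lam).real {d | epoch d n < t} = (lam * t / (1 + lam * t)) ^ n := by
    rw [← hle]
    refine measureReal_congr ?_
    have h0 := gcpIntertimeLaw_epoch_eq hlam n ht
    filter_upwards [compl_mem_ae_iff.2 h0] with d hd
    exact propext ⟨fun h => le_of_lt h, fun h => lt_of_le_of_ne h hd⟩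
  rw [← h, ofReal_measureReal]

/-! ### The telegraph motion without resets -/

/-- The law of the time spent up to `t` in the initial state. -/
def occupationLaw (lam t : ℝ) : Measure ℝ :=
  ENNReal.ofReal (1 / (1 + lam * t)) • Measure.dirac t +
    ENNReal.ofReal (lam / (1 + lam * t)) • volume.restrict (Ioo 0 t)

/-- The clocks of one run of the motion between two resets. -/
abbrev pairClocks (p : (ℕ → ℝ) × (ℕ → ℝ)) : Fin 2 → ℕ → ℝ := ![p.1, p.2]

lemma measurable_pairClocks : Measurable pairClocks :=
  measurable_pi_lambda _ fun i => by
    fin_cases i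
    · exact measurable_fst
    · exact measurable_snd

lemma measurable_evenTime_runDuration (t : ℝ) :
    Measurable fun p : (ℕ → ℝ) × (ℕ → ℝ) => evenTime (runDuration (pairClocks p) 0) t := by
  have h := measurable_pairClocks.position 1 0 0 (measurable_const (a := t))
  simpa only [position_zero_eq, zero_mul, sub_zero, one_mul, zero_add] using h

/-- Splitting by the number `n` of epochs of the first clock up to `u` turns the event into an
almost surely disjoint union of rectangles, whose probabilities form a geometric series. -/
lemma gcp_prod_lt_evenTime (hlam : 0 < lam) {u t : ℝ} (hu : 0 ≤ u) (hut : u < t) :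
    (gcpIntertimeLaw lam).prod (gcpIntertimeLaw lam)
      {p | u < evenTime (runDuration (pairClocks p) 0) t} =
      ENNReal.ofReal ((1 + lam * (t - u)) / (1 + lam * t)) := by
  have := isProbabilityMeasure_gcpIntertimeLaw hlam
  set S : ℕ → Set ((ℕ → ℝ) × (ℕ → ℝ)) := fun n =>
    {d : ℕ → ℝ | epoch d n ≤ u ∧ u < epoch d (n + 1)} ×ˢ {d : ℕ → ℝ | epoch d n < t - u} with hS
  have hSm : ∀ n, MeasurableSet (S n) := fun n =>
    (measurableSet_between_epochs n u).prod
      (measurableSet_lt (measurable_epoch n) measurable_const)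
  have hreg : ∀ᵐ p ∂(gcpIntertimeLaw lam).prod (gcpIntertimeLaw lam),
      IsRegular p.1 ∧ IsRegular p.2 :=
    (Measure.quasiMeasurePreserving_fst.ae (ae_isRegular_gcpIntertimeLaw hlam)).and
      (Measure.quasiMeasurePreserving_snd.ae (ae_isRegular_gcpIntertimeLaw hlam))
  have h1 : (gcpIntertimeLaw lam).prod (gcpIntertimeLaw lam)
      {p | u < evenTime (runDuration (pairClocks p) 0) t} =
      (gcpIntertimeLaw lam).prod (gcpIntertimeLaw lam) (⋃ n, S n) := by
    refine measure_congr ?_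
    filter_upwards [hreg] with p hp
    refine propext ?_
    change u < evenTime (runDuration (pairClocks p) 0) t ↔ p ∈ ⋃ n, S n
    have key := fun n (h : epoch p.1 n ≤ u) (h' : u < epoch p.1 (n + 1)) =>
      lt_evenTime_runDuration_iff (D := pairClocks p) hp.1 hp.2 (t := t) h h'
    rw [mem_iUnion]
    constructor
    · intro h
      obtain ⟨n, h₁, h₂⟩ := hp.1.exists_epoch_le_lt hu
      exact ⟨n, ⟨h₁, h₂⟩, (key n h₁ h₂).1 h⟩
    · rintro ⟨n, ⟨h₁, h₂⟩, h₃⟩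
      exact (key n h₁ h₂).2 h₃
  have h2 : (gcpIntertimeLaw lam).prod (gcpIntertimeLaw lam) (⋃ n, S n) =
      ∑' n, (gcpIntertimeLaw lam).prod (gcpIntertimeLaw lam) (S n) := by
    refine measure_iUnion₀ ?_ fun n => (hSm n).nullMeasurableSet
    intro i j hij
    refine measure_mono_null (t := {p | ¬ (IsRegular p.1 ∧ IsRegular p.2)}) ?_ hreg
    rintro p ⟨hi, hj⟩ hp
    exact hij ((hp.1.countUpTo_eq hi.1.1 hi.1.2).symm.trans (hp.1.countUpTo_eq hj.1.1 hj.1.2))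
  have ht : 0 < 1 + lam * t := by nlinarith
  have hu' : 0 < 1 + lam * u := by positivity
  have hw : 0 < t - u := by linarith
  have hw' : 0 < 1 + lam * (t - u) := by positivity
  have h3 : ∀ n, (gcpIntertimeLaw lam).prod (gcpIntertimeLaw lam) (S n) =
      ENNReal.ofReal ((1 / (1 + lam * u)) *
        (lam * u / (1 + lam * u) * (lam * (t - u) / (1 + lam * (t - u)))) ^ n) := by
    intro n
    have e : ∀ A B C : ℝ, B ≠ 0 → A ^ n / B ^ (n + 1) * C ^ n = 1 / B * (A / B * C) ^ n := by
      intro A B C hB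
      rw [mul_pow, div_pow, pow_succ]
      field_simp
    rw [hS, Measure.prod_prod, gcpIntertimeLaw_between_epochs hlam n hu,
      gcpIntertimeLaw_epoch_lt hlam n hw, ← ENNReal.ofReal_mul (by positivity)]
    rw [e _ _ _ hu'.ne']
  have hgeo : HasSum (fun n : ℕ => (1 / (1 + lam * u)) *
      (lam * u / (1 + lam * u) * (lam * (t - u) / (1 + lam * (t - u)))) ^ n)
      ((1 + lam * (t - u)) / (1 + lam * t)) := by
    have hr1 : lam * u / (1 + lam * u) * (lam * (t - u) / (1 + lam * (t - u))) < 1 := by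
      rw [div_mul_div_comm, div_lt_one (by positivity)]
      nlinarith [mul_nonneg hlam.le hu, mul_pos hlam hw]
    have h := (hasSum_geometric_of_lt_one (by positivity) hr1).mul_left (1 / (1 + lam * u))
    have e : 1 - lam * u / (1 + lam * u) * (lam * (t - u) / (1 + lam * (t - u))) =
        (1 + lam * t) / ((1 + lam * u) * (1 + lam * (t - u))) := by
      rw [div_mul_div_comm, eq_div_iff (by positivity), sub_mul, div_mul_cancel₀ _ (by positivity)]
      ring
    rw [e, show 1 / (1 + lam * u) * ((1 + lam * t) / ((1 + lam * u) * (1 + lam * (t - u))))⁻¹ =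
      (1 + lam * (t - u)) / (1 + lam * t) by field_simp] at h
    exact h
  rw [h1, h2]
  simp_rw [h3]
  rw [← ENNReal.ofReal_tsum_of_nonneg (fun n => by positivity) hgeo.summable, hgeo.tsum_eq]

/-- Both sides are probability measures, so comparing the tails on `Ioi u` suffices; only `0 ≤ u <
t` is not trivial. -/
lemma map_evenTime_gcp_prod (hlam : 0 < lam) {t : ℝ} (ht : 0 ≤ t) :
    ((gcpIntertimeLaw lam).prod (gcpIntertimeLaw lam)).map
      (fun p => evenTime (runDuration (pairClocks p) 0) t) = occupationLaw lam t := by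
  have := isProbabilityMeasure_gcpIntertimeLaw hlam
  have hm := measurable_evenTime_runDuration t
  have hp : 0 < 1 + lam * t := by positivity
  have hIoi : ∀ u, occupationLaw lam t (Ioi u) = ENNReal.ofReal (1 / (1 + lam * t)) *
      (if u < t then 1 else 0) + ENNReal.ofReal (lam / (1 + lam * t)) *
        ENNReal.ofReal (t - max u 0) := by
    intro u
    have : Ioi u ∩ Ioo 0 t = Ioo (max u 0) t := by
      ext x; simp only [mem_inter_iff, mem_Ioi, mem_Ioo, max_lt_iff]; tauto
    simp only [occupationLaw, Measure.add_apply, Measure.smul_apply, smul_eq_mul,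
      Measure.restrict_apply measurableSet_Ioi, this, Real.volume_Ioo,
      Measure.dirac_apply' _ measurableSet_Ioi, indicator_apply, mem_Ioi, Pi.one_apply]
  have hfull :
      ENNReal.ofReal (1 / (1 + lam * t)) + ENNReal.ofReal (lam / (1 + lam * t)) *
        ENNReal.ofReal t = 1 := by
    rw [← ENNReal.ofReal_mul (by positivity), ← ENNReal.ofReal_add (by positivity) (by positivity)]
    rw [show 1 / (1 + lam * t) + lam / (1 + lam * t) * t = 1 by field_simp]
    simp
  have hprob : IsProbabilityMeasure (occupationLaw lam t) := by
    constructor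
    simp only [occupationLaw, Measure.add_apply, Measure.smul_apply, smul_eq_mul,
      Measure.restrict_apply_univ, Real.volume_Ioo, measure_univ, mul_one, sub_zero]
    exact hfull
  have hprob' := Measure.isProbabilityMeasure_map (μ := (gcpIntertimeLaw lam).prod
    (gcpIntertimeLaw lam)) hm.aemeasurable
  refine Measure.ext_of_Iic _ _ fun u => ?_
  rw [← compl_Ioi, prob_compl_eq_one_sub measurableSet_Ioi,
    prob_compl_eq_one_sub measurableSet_Ioi]
  congr 1
  rw [Measure.map_apply hm measurableSet_Ioi, hIoi]
  rcases lt_or_ge u 0 with hu | hu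
  · have : (fun p => evenTime (runDuration (pairClocks p) 0) t) ⁻¹' Ioi u = univ := by
      ext p
      simp [hu.trans_le (evenTime_nonneg _ ht)]
    rw [this, measure_univ, if_pos (hu.trans_le ht), max_eq_right hu.le, sub_zero, mul_one]
    exact hfull.symm
  · rcases lt_or_ge u t with hut | hut
    · refine (gcp_prod_lt_evenTime hlam hu hut).trans ?_
      rw [if_pos hut, max_eq_left hu, mul_one, ← ENNReal.ofReal_mul (by positivity),
        ← ENNReal.ofReal_add (by positivity) (by
          have : 0 < t - u := by linarith
          positivity)]
      congr 1
      field_simp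
    · have : (fun p => evenTime (runDuration (pairClocks p) 0) t) ⁻¹' Ioi u = ∅ := by
        ext p
        simpa using (evenTime_le _ ht).trans hut
      rw [this, measure_empty, if_neg (not_lt.2 hut), max_eq_left hu,
        ENNReal.ofReal_of_nonpos (by linarith : t - u ≤ 0)]
      simp

end

section

variable {lam v₁ v₂ : ℝ}

/-- The law of the position at time `t` of the motion without resets. -/
def telegraphLaw (lam v₁ v₂ : ℝ) (j : Fin 2) (t : ℝ) : Measure ℝ :=
  ENNReal.ofReal (1 / (1 + lam * t)) • Measure.dirac (![v₁, v₂] j * t) +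
    ENNReal.ofReal (lam / ((v₁ - v₂) * (1 + lam * t))) • volume.restrict (Ioo (v₂ * t) (v₁ * t))

lemma map_volume_affine (a : ℝ) {b : ℝ} (hb : b ≠ 0) :
    (volume : Measure ℝ).map (fun x => a + b * x) = ENNReal.ofReal |b⁻¹| • volume := by
  have h : (fun x => a + b * x) = (a + ·) ∘ (b * ·) := rfl
  rw [h, ← Measure.map_map (measurable_const_add a) (measurable_const_mul b),
    Real.map_volume_mul_left hb, Measure.map_smul, map_add_left_eq_self]

lemma map_occupationLaw (hlam : 0 < lam) {t : ℝ} (ht : 0 ≤ t) (a : ℝ) {b : ℝ} (hb : b ≠ 0)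
    {s : Set ℝ} (hs : MeasurableSet s) (hpre : (fun x => a + b * x) ⁻¹' s = Ioo 0 t) :
    (occupationLaw lam t).map (fun x => a + b * x) =
      ENNReal.ofReal (1 / (1 + lam * t)) • Measure.dirac (a + b * t) +
        ENNReal.ofReal (lam / (|b| * (1 + lam * t))) • volume.restrict s := by
  have hm : Measurable fun x : ℝ => a + b * x := by fun_prop
  have hp : 0 < 1 + lam * t := by positivity
  rw [occupationLaw, Measure.map_add _ _ hm, Measure.map_smul, Measure.map_smul,
    Measure.map_dirac' hm, ← hpre, ← Measure.restrict_map hm hs, map_volume_affine a hb,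
    Measure.restrict_smul, smul_smul, ← ENNReal.ofReal_mul (by positivity)]
  congr 3
  rw [abs_inv]
  have := abs_pos.2 hb
  field_simp

lemma map_position_gcp_prod (hlam : 0 < lam) (hv : v₂ < v₁) (j : Fin 2) {t : ℝ} (ht : 0 ≤ t) :
    ((gcpIntertimeLaw lam).prod (gcpIntertimeLaw lam)).map
      (fun p => position v₁ v₂ (pairClocks p) j t) = telegraphLaw lam v₁ v₂ j t := by
  have := isProbabilityMeasure_gcpIntertimeLaw hlam
  have hm := measurable_evenTime_runDuration t
  -- The velocities are arbitrary here because the case `j = 1` uses them in reversed order, after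
  -- the two clocks are swapped.
  have h0 : ∀ v w : ℝ, ((gcpIntertimeLaw lam).prod (gcpIntertimeLaw lam)).map
      (fun p => position v w (pairClocks p) 0 t) =
      (occupationLaw lam t).map fun x => w * t + (v - w) * x := by
    intro v w
    rw [← map_evenTime_gcp_prod hlam ht, Measure.map_map (by fun_prop) hm]
    simp_rw [position_zero_eq]
    rfl
  have hd : 0 < v₁ - v₂ := sub_pos.2 hv
  fin_cases j
  · refine (h0 v₁ v₂).trans ?_
    rw [map_occupationLaw hlam ht _ hd.ne' (measurableSet_Ioo (a := v₂ * t) (b := v₁ * t)),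
      abs_of_pos hd, telegraphLaw]
    · congr 3
      simp
      ring
    · ext x
      simp only [mem_preimage, mem_Ioo]
      constructor
      · rintro ⟨h1, h2⟩
        exact ⟨by nlinarith, by nlinarith⟩
      · rintro ⟨h1, h2⟩
        exact ⟨by nlinarith, by nlinarith⟩
  · have hsw : (fun p : (ℕ → ℝ) × (ℕ → ℝ) => position v₁ v₂ (pairClocks p) 1 t) =
        (fun p => position v₂ v₁ (pairClocks p) 0 t) ∘ Prod.swap := by
      funext p
      rw [position_one_eq]
      have : (fun i => pairClocks p (1 - i)) = pairClocks p.swap := by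
        funext i
        fin_cases i <;> rfl
      rw [this]
      rfl
    change Measure.map (fun p => position v₁ v₂ (pairClocks p) 1 t) _ = telegraphLaw lam v₁ v₂ 1 t
    rw [hsw, ← Measure.map_map (measurable_pairClocks.position _ _ _ measurable_const)
      measurable_swap,
      Measure.prod_swap, h0, map_occupationLaw hlam ht _ (by linarith : v₂ - v₁ ≠ 0)
        (measurableSet_Ioo (a := v₂ * t) (b := v₁ * t)), abs_sub_comm, abs_of_pos hd, telegraphLaw]
    · congr 3
      simp
      ring
    · ext x
      simp only [mem_preimage, mem_Ioo]
      constructor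
      · rintro ⟨h1, h2⟩
        exact ⟨by nlinarith, by nlinarith⟩
      · rintro ⟨h1, h2⟩
        exact ⟨by nlinarith, by nlinarith⟩

/-! ### The motion with resets -/

variable {Ω : Type*} [MeasurableSpace Ω] {P : Measure Ω} {ξ q : ℝ} {J : Ω → Fin 2}
  {R : Ω → ℕ → ℝ} {D : Ω → ℕ → Fin 2 → ℕ → ℝ}

lemma IsDriver.measurable_clocks (h : IsDriver P lam ξ q J R D) (c : Option (ℕ × Fin 2)) :
    Measurable (clocks R D c) := by
  rcases c with _ | ⟨n, i⟩
  · exact h.measurable_R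
  · exact h.measurable_D n i

lemma IsDriver.measurable_resetPosition (h : IsDriver P lam ξ q J R D) (v₁ v₂ : ℝ) (j : Fin 2)
    (t : ℝ) : Measurable fun ω => resetPosition v₁ v₂ (R ω) (D ω) j t :=
  (ResetTelegraph.measurable_resetPosition v₁ v₂ j t).comp
    (f := fun ω c => clocks R D c ω) (measurable_pi_lambda _ h.measurable_clocks)

lemma IsDriver.measurable_resetPosition_random (h : IsDriver P lam ξ q J R D) (v₁ v₂ t : ℝ) :
    Measurable fun ω => resetPosition v₁ v₂ (R ω) (D ω) (J ω) t := by
  have : Measurable fun p : Ω × Fin 2 => resetPosition v₁ v₂ (R p.1) (D p.1) p.2 t :=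
    measurable_from_prod_countable_left fun j => h.measurable_resetPosition v₁ v₂ j t
  exact this.comp (f := fun ω => (ω, J ω)) (measurable_id.prodMk h.measurable_J)

/-- The pair of clocks used after the `n`-th reset is independent of the resets, so on the event of
exactly `n` resets only this joint law matters. -/
lemma IsDriver.map_prod [IsProbabilityMeasure P] (h : IsDriver P lam ξ q J R D) (n : ℕ) :
    P.map (fun ω => (R ω, (D ω n 0, D ω n 1))) =
      (poissonIntertimeLaw ξ).prod ((gcpIntertimeLaw lam).prod (gcpIntertimeLaw lam)) := by
  have h1 : IndepFun (fun ω => (D ω n 0, D ω n 1)) R P :=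
    h.indep_clocks.indepFun_prodMk h.measurable_clocks (some (n, 0)) (some (n, 1)) none
      (by simp) (by simp)
  have h2 : IndepFun (fun ω => D ω n 0) (fun ω => D ω n 1) P :=
    h.indep_clocks.indepFun (i := some (n, 0)) (j := some (n, 1)) (by simp)
  rw [(indepFun_iff_map_prod_eq_prod_map_map h.measurable_R.aemeasurable
    ((h.measurable_D n 0).prodMk (h.measurable_D n 1)).aemeasurable).1 h1.symm,
    (indepFun_iff_map_prod_eq_prod_map_map (h.measurable_D n 0).aemeasurable
      (h.measurable_D n 1).aemeasurable).1 h2, h.law_R, h.law_D, h.law_D]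

/-- The Erlang densities of all positive epochs add up to the constant `r`. So the last epoch before
`t` has density `r * exp (-(r * (t - s)))`, plus mass `exp (-(r * t))` at the origin; reflecting `s`
to `t - s` expresses this through the age. -/
lemma sum_lintegral_between_epochs {r : ℝ} (hr : 0 < r) {t : ℝ} (ht : 0 ≤ t) {φ : ℝ → ℝ≥0∞}
    (hφ : Measurable φ) :
    ∑' n, ∫⁻ d in {d | epoch d n ≤ t ∧ t < epoch d (n + 1)}, φ (epoch d n)
        ∂poissonIntertimeLaw r =
      ENNReal.ofReal (Real.exp (-(r * t))) * φ 0 +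
        ∫⁻ s in Icc 0 t, ENNReal.ofReal (r * Real.exp (-(r * s))) * φ (t - s) := by
  rw [tsum_eq_zero_add' ENNReal.summable, lintegral_between_epochs_zero hr ht hφ, mul_comm]
  congr 1
  simp_rw [lintegral_between_epochs_succ hr _ t hφ]
  rw [← lintegral_tsum (fun n => by fun_prop)]
  have h : ∀ s ∈ Icc 0 t, ∑' n : ℕ, φ s * ENNReal.ofReal
      (r * Real.exp (-(r * t)) * ((r * s) ^ n / n.factorial)) =
      ENNReal.ofReal (r * Real.exp (-(r * (t - s)))) * φ s := by
    intro s hs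
    have h0 := hs.1
    have hsum := (NormedSpace.expSeries_div_hasSum_exp (r * s)).mul_left (r * Real.exp (-(r * t)))
    rw [ENNReal.tsum_mul_left, ← ENNReal.ofReal_tsum_of_nonneg (fun n => by positivity)
      hsum.summable, hsum.tsum_eq, ← Real.exp_eq_exp_ℝ, mul_assoc, ← Real.exp_add, mul_comm]
    congr 4
    ring
  rw [setLIntegral_congr_fun measurableSet_Icc h, ← lintegral_indicator measurableSet_Icc,
    ← lintegral_indicator measurableSet_Icc, ← lintegral_sub_left_eq_self _ t]
  refine lintegral_congr fun s => ?_
  simp only [indicator_apply, mem_Icc, sub_sub_cancel, sub_nonneg, sub_le_self_iff, and_comm]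

/-- Conditionally on the resets, the position has the law of a fresh run whose length is the time
since the last reset. That law does not depend on the number of resets, so summing over it leaves an
average over the age. -/
lemma IsDriver.map_resetPosition_apply [IsProbabilityMeasure P] (h : IsDriver P lam ξ q J R D)
    (hlam : 0 < lam) (hξ : 0 < ξ) (hv : v₂ < v₁) (j : Fin 2) {t : ℝ} (ht : 0 ≤ t) {A : Set ℝ}
    (hA : MeasurableSet A) :
    P.map (fun ω => resetPosition v₁ v₂ (R ω) (D ω) j t) A =
      ENNReal.ofReal (Real.exp (-(ξ * t))) * telegraphLaw lam v₁ v₂ j t A +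
        ∫⁻ s in Icc 0 t, ENNReal.ofReal (ξ * Real.exp (-(ξ * s))) *
          telegraphLaw lam v₁ v₂ j s A := by
  have := isProbabilityMeasure_gcpIntertimeLaw hlam
  have := isProbabilityMeasure_poissonIntertimeLaw hξ
  set B : ℕ → Set (ℕ → ℝ) := fun n => {d | epoch d n ≤ t ∧ t < epoch d (n + 1)} with hB
  have hBm : ∀ n, MeasurableSet (B n) := fun n => measurableSet_between_epochs n t
  set S : ℕ → Set ((ℕ → ℝ) × ((ℕ → ℝ) × (ℕ → ℝ))) := fun n =>
    {p | p.1 ∈ B n ∧ position v₁ v₂ (pairClocks p.2) j (t - epoch p.1 n) ∈ A} with hS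
  have hpos : ∀ n, Measurable fun p : (ℕ → ℝ) × ((ℕ → ℝ) × (ℕ → ℝ)) =>
      position v₁ v₂ (pairClocks p.2) j (t - epoch p.1 n) := fun n =>
    (measurable_pairClocks.comp measurable_snd).position v₁ v₂ j
      (measurable_const.sub ((measurable_epoch n).comp measurable_fst))
  have hSm : ∀ n, MeasurableSet (S n) := fun n =>
    (measurable_fst (hBm n)).inter (hpos n hA)
  set X : ℕ → Ω → (ℕ → ℝ) × ((ℕ → ℝ) × (ℕ → ℝ)) := fun n ω => (R ω, (D ω n 0, D ω n 1)) with hX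
  have hXm : ∀ n, Measurable (X n) := fun n =>
    h.measurable_R.prodMk ((h.measurable_D n 0).prodMk (h.measurable_D n 1))
  have hreg : ∀ᵐ ω ∂P, IsRegular (R ω) :=
    ae_of_ae_map h.measurable_R.aemeasurable
      (by rw [h.law_R]; exact ae_isRegular_poissonIntertimeLaw hξ)
  have e1 : P.map (fun ω => resetPosition v₁ v₂ (R ω) (D ω) j t) A =
      P (⋃ n, X n ⁻¹' S n) := by
    rw [Measure.map_apply (h.measurable_resetPosition v₁ v₂ j t) hA]
    refine measure_congr ?_
    filter_upwards [hreg] with ω hω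
    refine propext ?_
    change resetPosition v₁ v₂ (R ω) (D ω) j t ∈ A ↔ ω ∈ ⋃ n, X n ⁻¹' S n
    have hD : ∀ n, pairClocks (D ω n 0, D ω n 1) = D ω n := fun n => by
      funext i
      fin_cases i <;> rfl
    obtain ⟨m, h1, h2⟩ := hω.exists_epoch_le_lt ht
    rw [mem_iUnion, resetPosition, hω.countUpTo_eq h1 h2]
    constructor
    · intro hmem
      refine ⟨m, ⟨h1, h2⟩, ?_⟩
      change position v₁ v₂ (pairClocks (D ω m 0, D ω m 1)) j (t - epoch (R ω) m) ∈ A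
      rwa [hD]
    · rintro ⟨n, ⟨h3, h4⟩, h5⟩
      have hmn : n = m := (hω.countUpTo_eq h3 h4).symm.trans (hω.countUpTo_eq h1 h2)
      subst hmn
      change position v₁ v₂ (pairClocks (D ω n 0, D ω n 1)) j (t - epoch (R ω) n) ∈ A at h5
      rwa [hD] at h5
  have e2 : P (⋃ n, X n ⁻¹' S n) = ∑' n, P (X n ⁻¹' S n) := by
    refine measure_iUnion₀ ?_ fun n => (hXm n (hSm n)).nullMeasurableSet
    intro i k hik
    refine measure_mono_null (t := {ω | ¬ IsRegular (R ω)}) ?_ hreg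
    rintro ω ⟨hi, hk⟩ hω
    exact hik ((hω.countUpTo_eq hi.1.1 hi.1.2).symm.trans (hω.countUpTo_eq hk.1.1 hk.1.2))
  set φ : ℝ → ℝ≥0∞ := fun s => (gcpIntertimeLaw lam).prod (gcpIntertimeLaw lam)
    {p | position v₁ v₂ (pairClocks p) j (t - s) ∈ A} with hφ
  have hφm : Measurable φ := by
    have hm : Measurable fun p : ℝ × ((ℕ → ℝ) × (ℕ → ℝ)) =>
        position v₁ v₂ (pairClocks p.2) j (t - p.1) :=
      (measurable_pairClocks.comp measurable_snd).position v₁ v₂ j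
        (measurable_const.sub measurable_fst)
    exact measurable_measure_prodMk_left (hm hA)
  have e3 : ∀ n, P (X n ⁻¹' S n) = ∫⁻ d in B n, φ (epoch d n) ∂poissonIntertimeLaw ξ := by
    intro n
    rw [← Measure.map_apply (hXm n) (hSm n), h.map_prod n, Measure.prod_apply (hSm n),
      ← lintegral_indicator (hBm n)]
    refine lintegral_congr fun d => ?_
    by_cases hd : d ∈ B n
    · rw [indicator_of_mem hd]
      congr 1
      ext p
      exact and_iff_right hd
    · rw [indicator_of_notMem hd]
      refine (congrArg _ (?_ : _ = ∅)).trans measure_empty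
      ext p
      simp only [mem_preimage, mem_empty_iff_false, iff_false]
      exact fun hp => hd hp.1
  -- The restriction `s ≤ t` keeps the run length nonnegative, as `map_position_gcp_prod` requires.
  have e4 : ∀ s ≤ t, φ s = telegraphLaw lam v₁ v₂ j (t - s) A := by
    intro s hs
    rw [← map_position_gcp_prod hlam hv j (sub_nonneg.2 hs), Measure.map_apply
      (measurable_pairClocks.position v₁ v₂ j measurable_const) hA]
    rfl
  rw [e1, e2]
  simp_rw [e3]
  rw [sum_lintegral_between_epochs hξ ht hφm, e4 0 ht, sub_zero]
  congr 1
  refine setLIntegral_congr_fun measurableSet_Icc fun s hs => ?_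
  rw [e4 (t - s) (by linarith [hs.1]), sub_sub_cancel]

lemma IsDriver.map_resetPosition_random [IsProbabilityMeasure P] (h : IsDriver P lam ξ q J R D)
    (v₁ v₂ t : ℝ) :
    P.map (fun ω => resetPosition v₁ v₂ (R ω) (D ω) (J ω) t) =
      ENNReal.ofReal q • P.map (fun ω => resetPosition v₁ v₂ (R ω) (D ω) 0 t) +
        ENNReal.ofReal (1 - q) • P.map (fun ω => resetPosition v₁ v₂ (R ω) (D ω) 1 t) := by
  have hJ : ∀ j, MeasurableSet {ω | J ω = j} := fun j => h.measurable_J (measurableSet_singleton j)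
  have hm := h.measurable_resetPosition v₁ v₂
  ext A hA
  have hind : ∀ j, P ({ω | J ω = j} ∩ {ω | resetPosition v₁ v₂ (R ω) (D ω) j t ∈ A}) =
      P {ω | J ω = j} * P {ω | resetPosition v₁ v₂ (R ω) (D ω) j t ∈ A} := by
    intro j
    have hF := ResetTelegraph.measurable_resetPosition v₁ v₂ j t
    have hI := h.indep_J.comp (measurable_id (α := Fin 2)) hF
    exact hI.measure_inter_preimage_eq_mul {j} A (measurableSet_singleton j) hA
  have hset : (fun ω => resetPosition v₁ v₂ (R ω) (D ω) (J ω) t) ⁻¹' A =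
      ({ω | J ω = 0} ∩ {ω | resetPosition v₁ v₂ (R ω) (D ω) 0 t ∈ A}) ∪
      ({ω | J ω = 1} ∩ {ω | resetPosition v₁ v₂ (R ω) (D ω) 1 t ∈ A}) := by
    ext ω
    simp only [mem_preimage, mem_union, mem_inter_iff, mem_ofPred_eq]
    generalize J ω = j
    fin_cases j <;> simp
  have hA1 : MeasurableSet ({ω | J ω = 1} ∩ {ω | resetPosition v₁ v₂ (R ω) (D ω) 1 t ∈ A}) :=
    (hJ 1).inter (hm 1 t hA)
  rw [Measure.map_apply (h.measurable_resetPosition_random v₁ v₂ t) hA, hset, measure_union ?_ hA1,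
    hind, hind,
    h.prob_J_zero, h.prob_J_one]
  · simp only [Measure.add_apply, Measure.smul_apply, smul_eq_mul, Measure.map_apply (hm _ t) hA]
    rfl
  · rw [Set.disjoint_left]
    rintro ω ⟨h0, _⟩ ⟨h1, _⟩
    exact absurd (h0.symm.trans h1) (by decide)

end

section

/-! ### Pointwise densities -/

/-- Lower semicontinuity bounds all short averages from below. Convergence on one side bounds the
averages on that side from above, and a lower limit needs such a bound only frequently. The atom
plays no part, being away from `x`. -/
lemma density_eq_of_lowerSemicontinuousAt {c : ℝ≥0∞} {a x : ℝ} {F : ℝ → ℝ≥0∞} (hxa : x ≠ a)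
    (hF : LowerSemicontinuousAt F x)
    (hside : Tendsto F (𝓝[<] x) (𝓝 (F x)) ∨ Tendsto F (𝓝[>] x) (𝓝 (F x))) :
    density (c • Measure.dirac a + volume.withDensity F) x = (F x).toReal := by
  set μ : Measure ℝ := c • Measure.dirac a + volume.withDensity F with hμ
  have hμ_near : ∀ᶠ y in 𝓝 x, μ (uIoc x y) = ∫⁻ z in uIoc x y, F z := by
    obtain ⟨l, u, hx, hlu⟩ := mem_nhds_iff_exists_Ioo_subset.1 (isOpen_compl_singleton.mem_nhds hxa)
    filter_upwards [Ioo_mem_nhds hx.1 hx.2] with y hy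
    have hsub : uIoc x y ⊆ {a}ᶜ := fun z hz => hlu
      ⟨(lt_min hx.1 hy.1).trans hz.1, hz.2.trans_lt (max_lt hx.2 hy.2)⟩
    have ha : a ∉ uIoc x y := fun h => hsub h rfl
    rw [hμ, Measure.add_apply, Measure.smul_apply, Measure.dirac_apply' _ measurableSet_uIoc,
      indicator_of_notMem ha, smul_zero, zero_add, withDensity_apply _ measurableSet_uIoc]
  have hvol : ∀ y, volume (uIoc x y) = ENNReal.ofReal |y - x| := fun y => Real.volume_uIoc
  have hpos : ∀ {y}, y ≠ x → ENNReal.ofReal |y - x| ≠ 0 := fun {y} h => by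
    simpa [sub_eq_zero] using h
  unfold density
  congr 1
  apply le_antisymm
  · refine le_of_forall_gt_imp_ge_of_dense fun b hb => ?_
    refine liminf_le_of_frequently_le' ?_
    have hupper : ∀ y, y ≠ x → μ (uIoc x y) = ∫⁻ z in uIoc x y, F z →
        (∀ z ∈ uIoc x y, F z ≤ b) → μ (uIoc x y) / ENNReal.ofReal |y - x| ≤ b := by
      intro y hy he hz
      rw [ENNReal.div_le_iff_le_mul (Or.inl (hpos hy)) (Or.inl ENNReal.ofReal_ne_top), he]
      calc ∫⁻ z in uIoc x y, F z ≤ ∫⁻ _ in uIoc x y, b :=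
            setLIntegral_mono' measurableSet_uIoc hz
        _ = b * ENNReal.ofReal |y - x| := by rw [setLIntegral_const, hvol]
    rcases hside with hs | hs
    · have hev := hs.eventually (gt_mem_nhds hb)
      obtain ⟨l, hl, hlx⟩ := (mem_nhdsLT_iff_exists_Ioo_subset).1 hev
      have hev2 : ∀ᶠ y in 𝓝[<] x, μ (uIoc x y) / ENNReal.ofReal |y - x| ≤ b := by
        filter_upwards [Ioo_mem_nhdsLT hl, nhdsWithin_le_nhds hμ_near] with y hy hy'
        refine hupper y hy.2.ne hy' fun z hz => ?_
        rw [uIoc_of_ge hy.2.le] at hz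
        rcases hz.2.eq_or_lt with rfl | hzx
        · exact hb.le
        · exact le_of_lt (hlx ⟨hy.1.trans hz.1, hzx⟩)
      exact hev2.frequently.filter_mono (nhdsWithin_mono _ fun y hy => ne_of_lt hy)
    · have hev := hs.eventually (gt_mem_nhds hb)
      obtain ⟨u, hu, hux⟩ := (mem_nhdsGT_iff_exists_Ioo_subset).1 hev
      have hev2 : ∀ᶠ y in 𝓝[>] x, μ (uIoc x y) / ENNReal.ofReal |y - x| ≤ b := by
        filter_upwards [Ioo_mem_nhdsGT hu, nhdsWithin_le_nhds hμ_near] with y hy hy'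
        refine hupper y hy.1.ne' hy' fun z hz => ?_
        rw [uIoc_of_le hy.1.le] at hz
        exact le_of_lt (hux ⟨hz.1, hz.2.trans_lt hy.2⟩)
      exact hev2.frequently.filter_mono (nhdsWithin_mono _ fun y hy => ne_of_gt hy)
  · refine le_of_forall_lt_imp_le_of_dense fun b hb => ?_
    refine le_liminf_of_le (by isBoundedDefault) ?_
    obtain ⟨l, u, hx, hlu⟩ := mem_nhds_iff_exists_Ioo_subset.1 (hF b hb)
    filter_upwards [self_mem_nhdsWithin, nhdsWithin_le_nhds hμ_near,
      nhdsWithin_le_nhds (Ioo_mem_nhds hx.1 hx.2)] with y hy hy' hyI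
    rw [ENNReal.le_div_iff_mul_le (Or.inl (hpos hy)) (Or.inl ENNReal.ofReal_ne_top), hy',
      ← hvol, ← setLIntegral_const]
    refine setLIntegral_mono' measurableSet_uIoc fun z hz => le_of_lt (hlu ?_)
    exact ⟨(lt_min hx.1 hyI.1).trans hz.1, hz.2.trans_lt (max_lt hx.2 hyI.2)⟩

lemma hasDerivAt_measureReal_Iic {c : ℝ≥0∞} {a x : ℝ} {f : ℝ → ℝ} (hxa : x ≠ a)
    (hf : Measurable f) (hf₀ : ∀ z, 0 ≤ f z) (hfx : ContinuousAt f x)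
    [IsFiniteMeasure (c • Measure.dirac a + volume.withDensity fun z => ENNReal.ofReal (f z))] :
    HasDerivAt (fun y =>
      (c • Measure.dirac a + volume.withDensity fun z => ENNReal.ofReal (f z)).real (Iic y))
      (f x) x := by
  set μ : Measure ℝ := c • Measure.dirac a + volume.withDensity fun z => ENNReal.ofReal (f z)
    with hμ
  -- Finiteness of the whole measure bounds the mass of its absolutely continuous part.
  have hint : Integrable f := by
    refine (lintegral_ofReal_ne_top_iff_integrable hf.aestronglyMeasurable
      (Eventually.of_forall hf₀)).1 ?_
    have h : ∫⁻ z, ENNReal.ofReal (f z) ≤ μ univ := by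
      rw [hμ, Measure.add_apply, withDensity_apply _ MeasurableSet.univ, Measure.restrict_univ]
      exact le_add_self
    exact (h.trans_lt (measure_lt_top μ univ)).ne
  have hreal : ∀ y, μ.real (Iic y) =
      (c * (Iic y).indicator 1 a).toReal + ∫ z in Iic y, f z := by
    intro y
    have h2 : ∫⁻ z in Iic y, ENNReal.ofReal (f z) = ENNReal.ofReal (∫ z in Iic y, f z) :=
      (ofReal_integral_eq_lintegral_ofReal hint.integrableOn (Eventually.of_forall hf₀)).symm
    have h1 : μ (Iic y) = c * (Iic y).indicator 1 a + ENNReal.ofReal (∫ z in Iic y, f z) := by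
      rw [hμ, Measure.add_apply, Measure.smul_apply, Measure.dirac_apply' _ measurableSet_Iic,
        withDensity_apply _ measurableSet_Iic, smul_eq_mul, h2]
    have h3 : c * (Iic y).indicator 1 a ≠ ⊤ := by
      refine ne_top_of_le_ne_top (measure_ne_top μ (Iic y)) ?_
      rw [h1]
      exact le_self_add
    rw [Measure.real, h1, ENNReal.toReal_add h3 ENNReal.ofReal_ne_top,
      ENNReal.toReal_ofReal (integral_nonneg hf₀)]
  -- Near `x` the atom stays on the same side of `y`, so it adds a constant to the distribution
  -- function.
  have hconst : ∀ᶠ y in 𝓝 x, (c * (Iic y).indicator 1 a).toReal =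
      (c * (Iic x).indicator 1 a).toReal := by
    rcases lt_or_gt_of_ne hxa with h | h
    · filter_upwards [gt_mem_nhds h] with y hy
      simp [not_le.2 hy, not_le.2 h]
    · filter_upwards [lt_mem_nhds h] with y hy
      simp [hy.le, h.le]
  have hd : HasDerivAt (fun y => (c * (Iic x).indicator 1 a).toReal +
      ((∫ z in Iic x, f z) + ∫ z in x..y, f z)) (f x) x := by
    refine HasDerivAt.const_add _ (HasDerivAt.const_add _ ?_)
    exact intervalIntegral.integral_hasDerivAt_right (by simp)
      hf.stronglyMeasurable.stronglyMeasurableAtFilter hfx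
  refine hd.congr_of_eventuallyEq ?_
  filter_upwards [hconst] with y hy
  rw [hreal, hy, ← intervalIntegral.integral_Iic_sub_Iic hint.integrableOn hint.integrableOn]
  ring

end

section

/-! ### The density of the motion with resets -/

/-- The density at `x` of the absolutely continuous part of `telegraphLaw` at time `s`. -/
def telegraphPDF (lam v₁ v₂ s x : ℝ) : ℝ :=
  (Ioo (v₂ * s) (v₁ * s)).indicator (fun _ => lam / ((v₁ - v₂) * (1 + lam * s))) x

/-- The density at `x` of `v` times the age at time `t`, when no velocity change occurred. -/
def hitPDF (lam ξ v t x : ℝ) : ℝ :=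
  (Ioc 0 t).indicator (fun s => |v|⁻¹ * (ξ * Real.exp (-(ξ * s)) * (1 / (1 + lam * s)))) (x / v)

/-- The contribution to the density of the runs that began with a reset and had a velocity change. -/
def spreadPDF (lam ξ v₁ v₂ t x : ℝ) : ℝ :=
  ∫ s in Ioc 0 t, ξ * Real.exp (-(ξ * s)) * telegraphPDF lam v₁ v₂ s x

/-- The density of the absolutely continuous part of the law of the motion with resets. -/
def resetPDF (lam ξ v₁ v₂ : ℝ) (j : Fin 2) (t x : ℝ) : ℝ :=
  Real.exp (-(ξ * t)) * telegraphPDF lam v₁ v₂ t x +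
    (hitPDF lam ξ (![v₁, v₂] j) t x + spreadPDF lam ξ v₁ v₂ t x)

variable {lam ξ v₁ v₂ : ℝ}

/-! ### Measurability, bounds and continuity of the three density terms -/

lemma measurable_telegraphPDF_uncurry (lam v₁ v₂ : ℝ) :
    Measurable fun p : ℝ × ℝ => telegraphPDF lam v₁ v₂ p.1 p.2 := by
  have hS : MeasurableSet {p : ℝ × ℝ | v₂ * p.1 < p.2 ∧ p.2 < v₁ * p.1} :=
    (measurableSet_lt (measurable_fst.const_mul _) measurable_snd).inter
      (measurableSet_lt measurable_snd (measurable_fst.const_mul _))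
  have hf : Measurable fun p : ℝ × ℝ => lam / ((v₁ - v₂) * (1 + lam * p.1)) := by fun_prop
  exact hf.indicator hS

lemma measurable_telegraphPDF (lam v₁ v₂ s : ℝ) : Measurable (telegraphPDF lam v₁ v₂ s) :=
  (measurable_telegraphPDF_uncurry lam v₁ v₂).comp (measurable_const.prodMk measurable_id)

lemma telegraphPDF_nonneg (hlam : 0 < lam) (hv : v₂ < v₁) {s : ℝ} (hs : 0 ≤ s) (x : ℝ) :
    0 ≤ telegraphPDF lam v₁ v₂ s x := by
  have := sub_pos.2 hv
  exact indicator_nonneg (fun _ _ => by positivity) _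

lemma telegraphPDF_le (hlam : 0 < lam) (hv : v₂ < v₁) {s : ℝ} (hs : 0 ≤ s) (x : ℝ) :
    telegraphPDF lam v₁ v₂ s x ≤ lam / (v₁ - v₂) := by
  have := sub_pos.2 hv
  rw [telegraphPDF, indicator_apply]
  split_ifs
  swap
  · positivity
  refine div_le_div_of_nonneg_left hlam.le this ?_
  exact le_mul_of_one_le_right this.le (by nlinarith)

lemma continuousAt_indicator_Ioo_const {a b x k : ℝ} (ha : x ≠ a) (hb : x ≠ b) :
    ContinuousAt ((Ioo a b).indicator fun _ => k) x := by
  by_cases hx : x ∈ Ioo a b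
  · refine (continuousAt_const (y := k)).congr ?_
    filter_upwards [Ioo_mem_nhds hx.1 hx.2] with y hy
    exact (indicator_of_mem hy fun _ => k).symm
  · have hx' : x ∉ Icc a b := fun h =>
      hx ⟨lt_of_le_of_ne h.1 ha.symm, lt_of_le_of_ne h.2 hb⟩
    refine (continuousAt_const (y := (0 : ℝ))).congr ?_
    filter_upwards [isClosed_Icc.isOpen_compl.mem_nhds hx'] with y hy
    exact (indicator_of_notMem (fun h => hy (Ioo_subset_Icc_self h)) _).symm

lemma continuousAt_telegraphPDF {s x : ℝ} (h₁ : x ≠ v₁ * s) (h₂ : x ≠ v₂ * s) :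
    ContinuousAt (telegraphPDF lam v₁ v₂ s) x :=
  continuousAt_indicator_Ioo_const h₂ h₁

lemma integrableOn_spread (hlam : 0 < lam) (hξ : 0 < ξ) (hv : v₂ < v₁) (x : ℝ) :
    IntegrableOn (fun s => ξ * Real.exp (-(ξ * s)) * telegraphPDF lam v₁ v₂ s x) (Ioi 0) := by
  have hexp : IntegrableOn (fun s => ξ * Real.exp (-(ξ * s)) * (lam / (v₁ - v₂))) (Ioi 0) := by
    have := ((exp_neg_integrableOn_Ioi 0 hξ).const_mul ξ).mul_const (lam / (v₁ - v₂))
    simpa only [neg_mul, IntegrableOn] using this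
  refine Integrable.mono' hexp ?_ ?_
  · refine Measurable.aestronglyMeasurable ?_
    exact (by fun_prop : Measurable fun s : ℝ => ξ * Real.exp (-(ξ * s))).mul
      ((measurable_telegraphPDF_uncurry lam v₁ v₂).comp (measurable_id.prodMk measurable_const))
  · refine (ae_restrict_mem measurableSet_Ioi).mono fun s hs => ?_
    have hs' : 0 ≤ s := le_of_lt hs
    rw [Real.norm_of_nonneg (mul_nonneg (by positivity) (telegraphPDF_nonneg hlam hv hs' x))]
    gcongr
    exact telegraphPDF_le hlam hv hs' x

lemma measurable_spreadPDF (lam ξ v₁ v₂ t : ℝ) : Measurable (spreadPDF lam ξ v₁ v₂ t) := by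
  have h : Measurable fun p : ℝ × ℝ =>
      ξ * Real.exp (-(ξ * p.2)) * telegraphPDF lam v₁ v₂ p.2 p.1 :=
    (by fun_prop : Measurable fun p : ℝ × ℝ => ξ * Real.exp (-(ξ * p.2))).mul
      ((measurable_telegraphPDF_uncurry lam v₁ v₂).comp measurable_swap)
  exact (StronglyMeasurable.integral_prod_right' (ν := volume.restrict (Ioc 0 t))
    h.stronglyMeasurable).measurable

lemma spreadPDF_nonneg (hlam : 0 < lam) (hξ : 0 < ξ) (hv : v₂ < v₁) (t x : ℝ) :
    0 ≤ spreadPDF lam ξ v₁ v₂ t x :=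
  setIntegral_nonneg measurableSet_Ioc fun s hs =>
    mul_nonneg (by positivity) (telegraphPDF_nonneg hlam hv hs.1.le x)

/-- For fixed `x` the integrand is discontinuous only for `s = x / v₁` or `s = x / v₂`, a null set,
so dominated convergence gives continuity even where the uniform densities jump. -/
lemma continuousAt_spreadPDF (hlam : 0 < lam) (hξ : 0 < ξ) (hv : v₂ < v₁) (hv₁ : v₁ ≠ 0)
    (hv₂ : v₂ ≠ 0) (t x : ℝ) : ContinuousAt (spreadPDF lam ξ v₁ v₂ t) x := by
  refine continuousAt_of_dominated (bound := fun s => ξ * Real.exp (-(ξ * s)) * (lam / (v₁ - v₂)))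
    ?_ ?_ ?_ ?_
  · exact Eventually.of_forall fun y =>
      ((integrableOn_spread hlam hξ hv y).mono_set Ioc_subset_Ioi_self).aestronglyMeasurable
  · refine Eventually.of_forall fun y => ?_
    refine (ae_restrict_mem measurableSet_Ioc).mono fun s hs => ?_
    rw [Real.norm_of_nonneg (mul_nonneg (by positivity) (telegraphPDF_nonneg hlam hv hs.1.le y))]
    gcongr
    exact telegraphPDF_le hlam hv hs.1.le y
  · exact Continuous.integrableOn_Ioc (by fun_prop)
  · have h : ∀ᵐ s ∂(volume : Measure ℝ).restrict (Ioc 0 t), s ≠ x / v₁ ∧ s ≠ x / v₂ :=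
      (ae_restrict_of_ae (volume.ae_ne _)).and (ae_restrict_of_ae (volume.ae_ne _))
    filter_upwards [h] with s hs
    refine continuousAt_const.mul (continuousAt_telegraphPDF ?_ ?_)
    · rintro rfl
      exact hs.1 (by field_simp)
    · rintro rfl
      exact hs.2 (by field_simp)

lemma measurable_hitPDF (lam ξ v t : ℝ) : Measurable (hitPDF lam ξ v t) := by
  have h : Measurable ((Ioc 0 t).indicator fun s : ℝ =>
      |v|⁻¹ * (ξ * Real.exp (-(ξ * s)) * (1 / (1 + lam * s)))) :=
    Measurable.indicator (by fun_prop) measurableSet_Ioc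
  exact h.comp (measurable_id.div_const v)

lemma hitPDF_nonneg (hlam : 0 < lam) (hξ : 0 < ξ) (v t x : ℝ) : 0 ≤ hitPDF lam ξ v t x :=
  indicator_nonneg (fun s hs => by have := hs.1; positivity) _

lemma continuousAt_hitPDF (hlam : 0 < lam) {v t x : ℝ} (hv : v ≠ 0) (hx : x ≠ 0)
    (hxt : x ≠ v * t) : ContinuousAt (hitPDF lam ξ v t) x := by
  have hg : ContinuousAt (fun y : ℝ => y / v) x := continuousAt_id.div_const v
  refine ContinuousAt.comp (f := fun y : ℝ => y / v) (x := x) (g := (Ioc 0 t).indicator fun s : ℝ =>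
      |v|⁻¹ * (ξ * Real.exp (-(ξ * s)) * (1 / (1 + lam * s)))) ?_ hg
  have h0 : x / v ≠ 0 := div_ne_zero hx hv
  have ht : x / v ≠ t := fun h => hxt (by rw [← h]; field_simp)
  by_cases hm : x / v ∈ Ioo 0 t
  · have hp : 1 + lam * (x / v) ≠ 0 := by
      have := hm.1
      positivity
    have hc : ContinuousAt (fun s : ℝ =>
        |v|⁻¹ * (ξ * Real.exp (-(ξ * s)) * (1 / (1 + lam * s)))) (x / v) := by
      refine continuousAt_const.mul (ContinuousAt.mul (by fun_prop) ?_)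
      exact continuousAt_const.div (by fun_prop) hp
    refine hc.congr ?_
    filter_upwards [Ioo_mem_nhds hm.1 hm.2] with y hy
    exact (indicator_of_mem (Ioo_subset_Ioc_self hy) (fun s : ℝ =>
      |v|⁻¹ * (ξ * Real.exp (-(ξ * s)) * (1 / (1 + lam * s))))).symm
  · have hm' : x / v ∉ Icc 0 t := fun h =>
      hm ⟨lt_of_le_of_ne h.1 h0.symm, lt_of_le_of_ne h.2 ht⟩
    refine (continuousAt_const (y := (0 : ℝ))).congr ?_
    filter_upwards [isClosed_Icc.isOpen_compl.mem_nhds hm'] with y hy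
    exact (indicator_of_notMem (fun h => hy (Ioc_subset_Icc_self h)) _).symm

lemma measurable_resetPDF (lam ξ v₁ v₂ : ℝ) (j : Fin 2) (t : ℝ) :
    Measurable (resetPDF lam ξ v₁ v₂ j t) :=
  (measurable_const.mul (measurable_telegraphPDF _ _ _ _)).add
    ((measurable_hitPDF _ _ _ _).add (measurable_spreadPDF _ _ _ _ _))

lemma resetPDF_nonneg (hlam : 0 < lam) (hξ : 0 < ξ) (hv : v₂ < v₁) (j : Fin 2) {t : ℝ}
    (ht : 0 ≤ t) (x : ℝ) : 0 ≤ resetPDF lam ξ v₁ v₂ j t x :=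
  add_nonneg (mul_nonneg (Real.exp_pos _).le (telegraphPDF_nonneg hlam hv ht x))
    (add_nonneg (hitPDF_nonneg hlam hξ _ _ _) (spreadPDF_nonneg hlam hξ hv _ _))

lemma vec_ne_zero (hv₁ : v₁ ≠ 0) (hv₂ : v₂ ≠ 0) (j : Fin 2) : ![v₁, v₂] j ≠ 0 := by
  fin_cases j
  · exact hv₁
  · exact hv₂

lemma ne_vec_mul {x t : ℝ} (h₁ : x ≠ v₁ * t) (h₂ : x ≠ v₂ * t) (j : Fin 2) :
    x ≠ ![v₁, v₂] j * t := by
  fin_cases j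
  · exact h₁
  · exact h₂

lemma continuousAt_resetPDF (hlam : 0 < lam) (hξ : 0 < ξ) (hv : v₂ < v₁) (hv₁ : v₁ ≠ 0)
    (hv₂ : v₂ ≠ 0) (j : Fin 2) {t x : ℝ} (hx : x ≠ 0) (h₁ : x ≠ v₁ * t) (h₂ : x ≠ v₂ * t) :
    ContinuousAt (resetPDF lam ξ v₁ v₂ j t) x :=
  (continuousAt_const.mul (continuousAt_telegraphPDF h₁ h₂)).add
    ((continuousAt_hitPDF hlam (vec_ne_zero hv₁ hv₂ j) hx (ne_vec_mul h₁ h₂ j)).add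
      (continuousAt_spreadPDF hlam hξ hv hv₁ hv₂ t x))

/-! ### The law of the reset motion as an atom plus a density -/

lemma lintegral_telegraphPDF (s : ℝ) {A : Set ℝ} (hA : MeasurableSet A) :
    ENNReal.ofReal (lam / ((v₁ - v₂) * (1 + lam * s))) * volume.restrict (Ioo (v₂ * s) (v₁ * s)) A =
      ∫⁻ x in A, ENNReal.ofReal (telegraphPDF lam v₁ v₂ s x) := by
  have h : ∀ x, ENNReal.ofReal (telegraphPDF lam v₁ v₂ s x) = (Ioo (v₂ * s) (v₁ * s)).indicator
      (fun _ => ENNReal.ofReal (lam / ((v₁ - v₂) * (1 + lam * s)))) x := by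
    intro x
    rw [telegraphPDF, indicator_apply, indicator_apply]
    split_ifs <;> simp
  simp_rw [h]
  rw [lintegral_indicator_const measurableSet_Ioo, Measure.restrict_apply hA,
    Measure.restrict_apply measurableSet_Ioo, inter_comm]

/-- The change of variables `x = v * s` turns a mixture of point masses at `v * s` into a density;
its Jacobian is the factor `|v|⁻¹`. -/
lemma lintegral_hitPDF (hξ : 0 < ξ) {v : ℝ} (hv : v ≠ 0) (t : ℝ) {A : Set ℝ}
    (hA : MeasurableSet A) :
    ∫⁻ s in Ioc 0 t, ENNReal.ofReal (ξ * Real.exp (-(ξ * s))) *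
        (ENNReal.ofReal (1 / (1 + lam * s)) * Measure.dirac (v * s) A) =
      ∫⁻ x in A, ENNReal.ofReal (hitPDF lam ξ v t x) := by
  classical
  set F : ℝ → ℝ≥0∞ := A.indicator fun x => (Ioc 0 t).indicator
    (fun s => ENNReal.ofReal (ξ * Real.exp (-(ξ * s)) * (1 / (1 + lam * s)))) (x / v) with hF
  have hFm : Measurable F := by
    have h : Measurable ((Ioc 0 t).indicator fun s : ℝ =>
        ENNReal.ofReal (ξ * Real.exp (-(ξ * s)) * (1 / (1 + lam * s)))) :=
      Measurable.indicator (by fun_prop) measurableSet_Ioc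
    exact (h.comp (measurable_id.div_const v)).indicator hA
  have e1 : ∀ s, (Ioc 0 t).indicator (fun s => ENNReal.ofReal (ξ * Real.exp (-(ξ * s))) *
      (ENNReal.ofReal (1 / (1 + lam * s)) * Measure.dirac (v * s) A)) s = F (v * s) := by
    intro s
    simp only [hF, indicator_apply, Measure.dirac_apply' _ hA, Pi.one_apply,
      mul_div_cancel_left₀ _ hv]
    by_cases hs : s ∈ Ioc 0 t
    · have := hs.1
      rw [if_pos hs, if_pos hs,
        ENNReal.ofReal_mul (p := ξ * Real.exp (-(ξ * s))) (by positivity)]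
      split_ifs <;> simp
    · simp [hs]
  have e2 : ∀ x, ENNReal.ofReal |v⁻¹| * F x =
      A.indicator (fun x => ENNReal.ofReal (hitPDF lam ξ v t x)) x := by
    intro x
    simp only [hF, hitPDF, indicator_apply]
    split_ifs
    · rw [← ENNReal.ofReal_mul (by positivity), abs_inv]
    · simp
    · simp
  rw [← lintegral_indicator measurableSet_Ioc, ← lintegral_indicator hA]
  simp_rw [e1, ← e2]
  rw [lintegral_const_mul _ hFm, ← lintegral_map hFm (measurable_const_mul v),
    Real.map_volume_mul_left hv, lintegral_smul_measure, smul_eq_mul]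

lemma lintegral_spreadPDF (hlam : 0 < lam) (hξ : 0 < ξ) (hv : v₂ < v₁) (t : ℝ) (A : Set ℝ) :
    ∫⁻ s in Ioc 0 t, ENNReal.ofReal (ξ * Real.exp (-(ξ * s))) *
        ∫⁻ x in A, ENNReal.ofReal (telegraphPDF lam v₁ v₂ s x) =
      ∫⁻ x in A, ENNReal.ofReal (spreadPDF lam ξ v₁ v₂ t x) := by
  have hm : Measurable fun p : ℝ × ℝ =>
      ENNReal.ofReal (ξ * Real.exp (-(ξ * p.1)) * telegraphPDF lam v₁ v₂ p.1 p.2) :=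
    ((by fun_prop : Measurable fun p : ℝ × ℝ => ξ * Real.exp (-(ξ * p.1))).mul
      (measurable_telegraphPDF_uncurry lam v₁ v₂)).ennreal_ofReal
  have e1 : ∀ s, ENNReal.ofReal (ξ * Real.exp (-(ξ * s))) *
      ∫⁻ x in A, ENNReal.ofReal (telegraphPDF lam v₁ v₂ s x) =
      ∫⁻ x in A, ENNReal.ofReal (ξ * Real.exp (-(ξ * s)) * telegraphPDF lam v₁ v₂ s x) := by
    intro s
    rw [← lintegral_const_mul _ (measurable_telegraphPDF _ _ _ _).ennreal_ofReal]
    refine lintegral_congr fun x => ?_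
    rw [← ENNReal.ofReal_mul (by positivity)]
  simp_rw [e1]
  rw [lintegral_lintegral_swap hm.aemeasurable]
  refine lintegral_congr fun x => ?_
  refine (ofReal_integral_eq_lintegral_ofReal
    ((integrableOn_spread hlam hξ hv x).mono_set Ioc_subset_Ioi_self) ?_).symm
  exact (ae_restrict_mem measurableSet_Ioc).mono fun s hs =>
    mul_nonneg (by positivity) (telegraphPDF_nonneg hlam hv hs.1.le x)

variable {Ω : Type*} [MeasurableSpace Ω] {P : Measure Ω} {q : ℝ} {J : Ω → Fin 2}
  {R : Ω → ℕ → ℝ} {D : Ω → ℕ → Fin 2 → ℕ → ℝ}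

lemma IsDriver.map_resetPosition [IsProbabilityMeasure P] (h : IsDriver P lam ξ q J R D)
    (hlam : 0 < lam) (hξ : 0 < ξ) (hv : v₂ < v₁) (hv₁ : v₁ ≠ 0) (hv₂ : v₂ ≠ 0) (j : Fin 2)
    {t : ℝ} (ht : 0 ≤ t) :
    P.map (fun ω => resetPosition v₁ v₂ (R ω) (D ω) j t) =
      ENNReal.ofReal (Real.exp (-(ξ * t)) * (1 / (1 + lam * t))) •
          Measure.dirac (![v₁, v₂] j * t) +
        volume.withDensity fun x => ENNReal.ofReal (resetPDF lam ξ v₁ v₂ j t x) := by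
  ext A hA
  have htel : ∀ s, telegraphLaw lam v₁ v₂ j s A =
      ENNReal.ofReal (1 / (1 + lam * s)) * Measure.dirac (![v₁, v₂] j * s) A +
        ∫⁻ x in A, ENNReal.ofReal (telegraphPDF lam v₁ v₂ s x) := by
    intro s
    rw [← lintegral_telegraphPDF s hA]
    rfl
  have hmd : Measurable fun s : ℝ => Measure.dirac (![v₁, v₂] j * s) A := by
    simp_rw [Measure.dirac_apply' _ hA]
    exact (measurable_one.indicator hA).comp (measurable_const_mul _)
  have hpdf : ∀ x, ENNReal.ofReal (resetPDF lam ξ v₁ v₂ j t x) =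
      ENNReal.ofReal (Real.exp (-(ξ * t))) * ENNReal.ofReal (telegraphPDF lam v₁ v₂ t x) +
        (ENNReal.ofReal (hitPDF lam ξ (![v₁, v₂] j) t x) +
          ENNReal.ofReal (spreadPDF lam ξ v₁ v₂ t x)) := by
    intro x
    rw [resetPDF, ENNReal.ofReal_add (mul_nonneg (Real.exp_pos _).le
      (telegraphPDF_nonneg hlam hv ht x)) (add_nonneg (hitPDF_nonneg hlam hξ _ _ _)
      (spreadPDF_nonneg hlam hξ hv _ _)), ENNReal.ofReal_add (hitPDF_nonneg hlam hξ _ _ _)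
      (spreadPDF_nonneg hlam hξ hv _ _), ENNReal.ofReal_mul (Real.exp_pos _).le]
  -- Passing from `Icc` to `Ioc` drops the null age `s = 0`; accordingly `hitPDF` vanishes at the
  -- origin, as `Hbar` does.
  rw [h.map_resetPosition_apply hlam hξ hv j ht hA, Measure.add_apply, Measure.smul_apply,
    withDensity_apply _ hA, setLIntegral_congr (Ioc_ae_eq_Icc (a := (0 : ℝ)) (b := t)).symm]
  simp_rw [htel, hpdf, mul_add]
  rw [lintegral_add_left (by fun_prop), lintegral_add_left
    ((measurable_telegraphPDF _ _ _ _).ennreal_ofReal.const_mul _),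
    lintegral_add_left (measurable_hitPDF _ _ _ _).ennreal_ofReal,
    lintegral_hitPDF hξ (vec_ne_zero hv₁ hv₂ j) t hA, lintegral_spreadPDF hlam hξ hv,
    lintegral_const_mul _ (measurable_telegraphPDF _ _ _ _).ennreal_ofReal,
    ENNReal.ofReal_mul (Real.exp_pos _).le, smul_eq_mul]
  ring

end

variable {lam ξ v₁ v₂ : ℝ}

/-! ### The density at a point -/

lemma hitPDF_of_nonpos {v t x : ℝ} (h : x / v ≤ 0) : hitPDF lam ξ v t x = 0 :=
  indicator_of_notMem (fun hm => not_lt.2 h hm.1) _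

lemma density_resetPDF (hlam : 0 < lam) (hξ : 0 < ξ) (hv : v₂ < v₁) (hv₁ : v₁ ≠ 0)
    (hv₂ : v₂ ≠ 0) (j : Fin 2) {t x : ℝ} (ht : 0 < t) (h₁ : x ≠ v₁ * t) (h₂ : x ≠ v₂ * t)
    (c : ℝ≥0∞) :
    density (c • Measure.dirac (![v₁, v₂] j * t) +
      volume.withDensity fun x => ENNReal.ofReal (resetPDF lam ξ v₁ v₂ j t x)) x =
      resetPDF lam ξ v₁ v₂ j t x := by
  have hcont : x ≠ 0 → ContinuousAt
      (fun x => ENNReal.ofReal (resetPDF lam ξ v₁ v₂ j t x)) x := fun hx =>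
    ENNReal.continuous_ofReal.continuousAt.comp
      (continuousAt_resetPDF hlam hξ hv hv₁ hv₂ j hx h₁ h₂)
  -- `K` is the density without the hitting term. It is continuous even at `0`, lies below the full
  -- density, and agrees with it on the side `y / v_j ≤ 0`, origin included. This gives lower
  -- semicontinuity and the one-sided limit at `0`.
  set K : ℝ → ℝ≥0∞ := fun y => ENNReal.ofReal
    (Real.exp (-(ξ * t)) * telegraphPDF lam v₁ v₂ t y + spreadPDF lam ξ v₁ v₂ t y) with hK
  have hKc : ContinuousAt K x :=
    ENNReal.continuous_ofReal.continuousAt.comp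
      ((continuousAt_const.mul (continuousAt_telegraphPDF h₁ h₂)).add
        (continuousAt_spreadPDF hlam hξ hv hv₁ hv₂ t x))
  have hKle : ∀ y, K y ≤ ENNReal.ofReal (resetPDF lam ξ v₁ v₂ j t y) := fun y => by
    refine ENNReal.ofReal_le_ofReal ?_
    rw [resetPDF]
    linarith [hitPDF_nonneg hlam hξ (![v₁, v₂] j) t y]
  have hKeq : ∀ y, y / ![v₁, v₂] j ≤ 0 → ENNReal.ofReal (resetPDF lam ξ v₁ v₂ j t y) = K y := by
    intro y hy
    rw [resetPDF, hitPDF_of_nonpos hy, zero_add]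
  refine (density_eq_of_lowerSemicontinuousAt (ne_vec_mul h₁ h₂ j) ?_ ?_).trans
    (ENNReal.toReal_ofReal (resetPDF_nonneg hlam hξ hv j ht.le x))
  · by_cases hx : x = 0
    · intro b hb
      have hb' : b < K x := by
        rw [← hKeq x (by simp [hx])]
        exact hb
      filter_upwards [hKc.eventually (lt_mem_nhds hb')] with y hy
      exact hy.trans_le (hKle y)
    · exact (hcont hx).lowerSemicontinuousAt
  · by_cases hx : x = 0
    · rw [hKeq x (by simp [hx])]
      rcases lt_or_gt_of_ne (vec_ne_zero hv₁ hv₂ j) with hneg | hpos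
      · right
        refine Tendsto.congr' ?_ (hKc.tendsto.mono_left nhdsWithin_le_nhds)
        filter_upwards [self_mem_nhdsWithin] with y hy
        rw [hx] at hy
        exact (hKeq y (div_nonpos_of_nonneg_of_nonpos (le_of_lt hy) hneg.le)).symm
      · left
        refine Tendsto.congr' ?_ (hKc.tendsto.mono_left nhdsWithin_le_nhds)
        filter_upwards [self_mem_nhdsWithin] with y hy
        rw [hx] at hy
        exact (hKeq y (div_nonpos_of_nonpos_of_nonneg (le_of_lt hy) hpos.le)).symm
    · exact Or.inl ((hcont hx).tendsto.mono_left nhdsWithin_le_nhds)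

/-! ### The limit of the density -/

lemma tendsto_exp_mul_telegraphPDF (hlam : 0 < lam) (hξ : 0 < ξ) (hv : v₂ < v₁) (x : ℝ) :
    Tendsto (fun t => Real.exp (-(ξ * t)) * telegraphPDF lam v₁ v₂ t x) atTop (𝓝 0) := by
  have h : Tendsto (fun t : ℝ => Real.exp (-(ξ * t)) * (lam / (v₁ - v₂))) atTop (𝓝 0) := by
    have := (Real.tendsto_exp_neg_atTop_nhds_zero.comp
      (tendsto_id.const_mul_atTop hξ)).mul_const (lam / (v₁ - v₂))
    rwa [zero_mul] at this
  refine squeeze_zero' ?_ ?_ h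
  · filter_upwards [eventually_ge_atTop 0] with t ht
    exact mul_nonneg (Real.exp_pos _).le (telegraphPDF_nonneg hlam hv ht x)
  · filter_upwards [eventually_ge_atTop 0] with t ht
    exact mul_le_mul_of_nonneg_left (telegraphPDF_le hlam hv ht x) (Real.exp_pos _).le

/-- Once `t` has passed the hitting time `x / v`, the truncation in `hitPDF` is inactive; `sign v`
turns `v` into `|v|` in the denominator. -/
lemma hitPDF_eq_Hbar (hlam : 0 < lam) {v t x : ℝ} (hv : v ≠ 0) (ht : x / v ≤ t) :
    hitPDF lam ξ v t x = Hbar lam ξ v x := by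
  rw [hitPDF, Hbar]
  by_cases h : 0 < x / v
  · rw [indicator_of_mem (show x / v ∈ Ioc 0 t from ⟨h, ht⟩), if_pos h, ← neg_mul]
    have hp : 0 < 1 + lam * (x / v) := by positivity
    have e : v + lam * x = v * (1 + lam * (x / v)) := by field_simp
    rw [e]
    rcases lt_or_gt_of_ne hv with hn | hn
    · rw [abs_of_neg hn, Real.sign_of_neg hn]
      field_simp
    · rw [abs_of_pos hn, Real.sign_of_pos hn]
      field_simp
  · rw [indicator_of_notMem (fun hm => h hm.1), if_neg h]

lemma tendsto_hitPDF (hlam : 0 < lam) {v : ℝ} (hv : v ≠ 0) (x : ℝ) :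
    Tendsto (fun t => hitPDF lam ξ v t x) atTop (𝓝 (Hbar lam ξ v x)) := by
  refine tendsto_const_nhds.congr' ?_
  filter_upwards [eventually_ge_atTop (x / v)] with t ht
  exact (hitPDF_eq_Hbar hlam hv ht).symm

lemma tendsto_spreadPDF (hlam : 0 < lam) (hξ : 0 < ξ) (hv : v₂ < v₁) (x : ℝ) :
    Tendsto (fun t => spreadPDF lam ξ v₁ v₂ t x) atTop
      (𝓝 (∫ s in Ioi 0, ξ * Real.exp (-(ξ * s)) * telegraphPDF lam v₁ v₂ s x)) := by
  refine (intervalIntegral_tendsto_integral_Ioi 0 (integrableOn_spread hlam hξ hv x)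
    tendsto_id).congr' ?_
  filter_upwards [eventually_ge_atTop 0] with t ht
  exact intervalIntegral.integral_of_le ht

lemma tendsto_resetPDF (hlam : 0 < lam) (hξ : 0 < ξ) (hv : v₂ < v₁) (hv₁ : v₁ ≠ 0)
    (hv₂ : v₂ ≠ 0) (j : Fin 2) (x : ℝ) :
    Tendsto (fun t => resetPDF lam ξ v₁ v₂ j t x) atTop
      (𝓝 (Hbar lam ξ (![v₁, v₂] j) x +
        ∫ s in Ioi 0, ξ * Real.exp (-(ξ * s)) * telegraphPDF lam v₁ v₂ s x)) := by
  have h := (tendsto_exp_mul_telegraphPDF hlam hξ hv x).add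
    ((tendsto_hitPDF (ξ := ξ) hlam (vec_ne_zero hv₁ hv₂ j) x).add
      (tendsto_spreadPDF hlam hξ hv x))
  rwa [zero_add] at h

/-- With `u = ξ * (s + 1 / lam)` one has `1 + lam * s = lam * u / ξ` and `exp (-(ξ * s)) = exp (ξ /
lam) * exp (-u)`. The set `S` is the image of the times at which `x` is inside the range of the
motion. -/
lemma integral_spread_eq (hlam : 0 < lam) (hξ : 0 < ξ) {x : ℝ} {S : Set ℝ} (hS : MeasurableSet S)
    (hmem : ∀ s, (0 < s ∧ v₂ * s < x ∧ x < v₁ * s) ↔ ξ * (s + 1 / lam) ∈ S) :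
    ∫ s in Ioi 0, ξ * Real.exp (-(ξ * s)) * telegraphPDF lam v₁ v₂ s x =
      ξ * Real.exp (ξ / lam) / (v₁ - v₂) * ∫ u in S, u ^ ((0 : ℝ) - 1) * Real.exp (-u) := by
  classical
  have hpt : ∀ s, (Ioi 0).indicator
      (fun s => ξ * Real.exp (-(ξ * s)) * telegraphPDF lam v₁ v₂ s x) s =
      ξ * Real.exp (ξ / lam) / (v₁ - v₂) * ξ *
        S.indicator (fun u => u ^ ((0 : ℝ) - 1) * Real.exp (-u)) (ξ * (s + 1 / lam)) := by
    intro s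
    have hm := hmem s
    simp only [telegraphPDF, indicator_apply, mem_Ioi, mem_Ioo, ← hm]
    by_cases h0 : 0 < s
    · by_cases h1 : v₂ * s < x ∧ x < v₁ * s
      · rw [if_pos h0, if_pos h1, if_pos ⟨h0, h1⟩, zero_sub, Real.rpow_neg_one]
        have e : Real.exp (-(ξ * (s + 1 / lam))) =
            Real.exp (-(ξ * s)) * (Real.exp (ξ / lam))⁻¹ := by
          rw [← Real.exp_neg, ← Real.exp_add]
          ring_nf
        have e2 : s + 1 / lam = (1 + lam * s) / lam := by field_simp; ring
        have hp : 0 < 1 + lam * s := by positivity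
        have hE := Real.exp_pos (ξ / lam)
        rw [e, e2]
        have hd : v₁ - v₂ ≠ 0 := by
          intro h
          have : v₁ = v₂ := sub_eq_zero.1 h
          rw [this] at h1
          exact lt_irrefl _ (h1.1.trans h1.2)
        field_simp
      · rw [if_pos h0, if_neg h1, if_neg (fun h => h1 h.2)]
        simp
    · rw [if_neg h0, if_neg (fun h => h0 h.1)]
      simp
  rw [← integral_indicator measurableSet_Ioi, ← integral_indicator hS]
  simp_rw [hpt]
  rw [integral_const_mul, integral_add_right_eq_self (fun s : ℝ =>
    S.indicator (fun u => u ^ ((0 : ℝ) - 1) * Real.exp (-u)) (ξ * s)) (1 / lam),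
    Measure.integral_comp_mul_left, abs_of_pos (inv_pos.2 hξ), smul_eq_mul, mul_assoc,
    mul_inv_cancel_left₀ hξ.ne']

lemma integral_spread_of_opposite (hlam : 0 < lam) (hξ : 0 < ξ) (h₂ : v₂ < 0) (h₁ : 0 < v₁)
    (x : ℝ) :
    ∫ s in Ioi 0, ξ * Real.exp (-(ξ * s)) * telegraphPDF lam v₁ v₂ s x =
      ξ * Real.exp (ξ / lam) / (v₁ - v₂) *
        upperIncGamma 0 ((max (x / v₁) (x / v₂) + 1 / lam) * ξ) := by
  refine integral_spread_eq hlam hξ measurableSet_Ioi fun s => ?_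
  rw [mem_Ioi, mul_comm _ ξ, mul_lt_mul_iff_right₀ hξ, add_lt_add_iff_right, max_lt_iff,
    div_lt_iff₀ h₁, div_lt_iff_of_neg h₂, mul_comm s, mul_comm s]
  refine ⟨fun h => ⟨h.2.2, h.2.1⟩, fun h => ⟨?_, h.2, h.1⟩⟩
  -- A time `s ≤ 0` would give `v₁ * s ≤ 0 ≤ v₂ * s`, incompatible with `v₂ * s < x < v₁ * s`.
  by_contra hs
  nlinarith

lemma integral_spread_of_pos (hlam : 0 < lam) (hξ : 0 < ξ) (h₂ : 0 < v₂) (h₁ : v₂ < v₁) (x : ℝ) :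
    ∫ s in Ioi 0, ξ * Real.exp (-(ξ * s)) * telegraphPDF lam v₁ v₂ s x =
      posIndicator x * (ξ * Real.exp (ξ / lam) / (v₁ - v₂)) *
        genIncGamma 0 ((x / v₁ + 1 / lam) * ξ) ((x / v₂ + 1 / lam) * ξ) := by
  have hv₁ : 0 < v₁ := h₂.trans h₁
  by_cases hx : 0 < x
  · have hle : (x / v₁ + 1 / lam) * ξ ≤ (x / v₂ + 1 / lam) * ξ := by gcongr
    rw [posIndicator, if_pos hx, one_mul, genIncGamma, intervalIntegral.integral_of_le hle,
      integral_Ioc_eq_integral_Ioo]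
    refine integral_spread_eq hlam hξ measurableSet_Ioo fun s => ?_
    rw [mem_Ioo, mul_comm _ ξ, mul_comm _ ξ, mul_lt_mul_iff_right₀ hξ, mul_lt_mul_iff_right₀ hξ,
      add_lt_add_iff_right, add_lt_add_iff_right, div_lt_iff₀ hv₁, lt_div_iff₀ h₂, mul_comm s,
      mul_comm s]
    refine ⟨fun h => ⟨h.2.2, h.2.1⟩, fun h => ⟨?_, h.2, h.1⟩⟩
    exact pos_of_mul_pos_right (hx.trans h.1) hv₁.le
  · rw [posIndicator, if_neg hx, zero_mul, zero_mul]
    -- For `x ≤ 0` no positive time satisfies `v₂ * s < x`, so the substitution is applied with the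
    -- empty set.
    have h := integral_spread_eq (v₁ := v₁) (v₂ := v₂) (x := x) hlam hξ MeasurableSet.empty
      fun s => ⟨fun h => hx ((mul_pos h₂ h.1).trans h.2.1), fun h => h.elim⟩
    rw [h]
    simp

/-! ### The random initial velocity -/

variable {Ω : Type*} [MeasurableSpace Ω] {P : Measure Ω} {q : ℝ} {J : Ω → Fin 2}
  {R : Ω → ℕ → ℝ} {D : Ω → ℕ → Fin 2 → ℕ → ℝ}

lemma IsDriver.mixedPDF_eq [IsProbabilityMeasure P] (h : IsDriver P lam ξ q J R D)
    (hlam : 0 < lam) (hξ : 0 < ξ) (hv : v₂ < v₁) (hv₁ : v₁ ≠ 0) (hv₂ : v₂ ≠ 0) {t x : ℝ}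
    (ht : 0 < t) (h₁ : x ≠ v₁ * t) (h₂ : x ≠ v₂ * t) :
    mixedPDF P v₁ v₂ q R D x t =
      q * resetPDF lam ξ v₁ v₂ 0 t x + (1 - q) * resetPDF lam ξ v₁ v₂ 1 t x := by
  have hj : ∀ j, condPDF P v₁ v₂ R D j x t = resetPDF lam ξ v₁ v₂ j t x := by
    intro j
    rw [condPDF, h.map_resetPosition hlam hξ hv hv₁ hv₂ j ht.le]
    exact density_resetPDF hlam hξ hv hv₁ hv₂ j ht h₁ h₂ _
  rw [mixedPDF, hj, hj]

/-- Removing the two extremes kills both atoms and does not alter Lebesgue measure; this also makes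
the values of `mixedPDF` at the extremes irrelevant. -/
lemma IsDriver.restrict_map_resetPosition [IsProbabilityMeasure P] (h : IsDriver P lam ξ q J R D)
    (hlam : 0 < lam) (hξ : 0 < ξ) (hq₀ : 0 ≤ q) (hq₁ : q ≤ 1) (hv : v₂ < v₁) (hv₁ : v₁ ≠ 0)
    (hv₂ : v₂ ≠ 0) {t : ℝ} (ht : 0 < t) :
    (P.map fun ω => resetPosition v₁ v₂ (R ω) (D ω) (J ω) t).restrict
        ({v₁ * t, v₂ * t} : Set ℝ)ᶜ =
      volume.withDensity fun x => ENNReal.ofReal (mixedPDF P v₁ v₂ q R D x t) := by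
  have hS : MeasurableSet ({v₁ * t, v₂ * t} : Set ℝ)ᶜ := (toFinite _).measurableSet.compl
  have hnull : ∀ᵐ x ∂(volume : Measure ℝ), x ∈ ({v₁ * t, v₂ * t} : Set ℝ)ᶜ :=
    compl_mem_ae_iff.2 ((toFinite _).measure_zero _)
  have hae : (fun x => ENNReal.ofReal (mixedPDF P v₁ v₂ q R D x t)) =ᵐ[volume] fun x =>
      ENNReal.ofReal q * ENNReal.ofReal (resetPDF lam ξ v₁ v₂ 0 t x) +
        ENNReal.ofReal (1 - q) * ENNReal.ofReal (resetPDF lam ξ v₁ v₂ 1 t x) := by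
    filter_upwards [hnull] with x hx
    simp only [mem_compl_iff, mem_insert_iff, mem_singleton_iff, not_or] at hx
    have n := fun j => resetPDF_nonneg hlam hξ hv j ht.le x
    rw [h.mixedPDF_eq hlam hξ hv hv₁ hv₂ ht hx.1 hx.2, ENNReal.ofReal_add
      (mul_nonneg hq₀ (n 0)) (mul_nonneg (sub_nonneg.2 hq₁) (n 1)), ENNReal.ofReal_mul hq₀,
      ENNReal.ofReal_mul (sub_nonneg.2 hq₁)]
  have hj : ∀ j, (P.map fun ω => resetPosition v₁ v₂ (R ω) (D ω) j t).restrict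
      ({v₁ * t, v₂ * t} : Set ℝ)ᶜ =
      volume.withDensity fun x => ENNReal.ofReal (resetPDF lam ξ v₁ v₂ j t x) := by
    intro j
    have hmem : ![v₁, v₂] j * t ∉ ({v₁ * t, v₂ * t} : Set ℝ)ᶜ := by
      fin_cases j <;> simp
    rw [h.map_resetPosition hlam hξ hv hv₁ hv₂ j ht.le, Measure.restrict_add,
      Measure.restrict_smul, restrict_dirac' hS, if_neg hmem, smul_zero, zero_add,
      restrict_withDensity hS, Measure.restrict_eq_self_of_ae_mem hnull]
  have hm := fun j => (measurable_resetPDF lam ξ v₁ v₂ j t).ennreal_ofReal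
  rw [h.map_resetPosition_random, Measure.restrict_add, Measure.restrict_smul,
    Measure.restrict_smul, hj, hj, withDensity_congr_ae hae, ← withDensity_smul _ (hm 0),
    ← withDensity_smul _ (hm 1), ← withDensity_add_left ((hm 0).const_smul _)]
  rfl

lemma IsDriver.hasDerivAt_cdf [IsProbabilityMeasure P] (h : IsDriver P lam ξ q J R D)
    (hlam : 0 < lam) (hξ : 0 < ξ) (hq₀ : 0 ≤ q) (hq₁ : q ≤ 1) (hv : v₂ < v₁) (hv₁ : v₁ ≠ 0)
    (hv₂ : v₂ ≠ 0) {t x : ℝ} (ht : 0 < t) (hx : x ≠ 0) (h₁ : x ≠ v₁ * t) (h₂ : x ≠ v₂ * t) :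
    HasDerivAt (fun y => P.real {ω | resetPosition v₁ v₂ (R ω) (D ω) (J ω) t ≤ y})
      (mixedPDF P v₁ v₂ q R D x t) x := by
  have hj : ∀ j, HasDerivAt
      (fun y => (P.map fun ω => resetPosition v₁ v₂ (R ω) (D ω) j t).real (Iic y))
      (resetPDF lam ξ v₁ v₂ j t x) x := by
    intro j
    have hp := Measure.isProbabilityMeasure_map (μ := P)
      (h.measurable_resetPosition v₁ v₂ j t).aemeasurable
    rw [h.map_resetPosition hlam hξ hv hv₁ hv₂ j ht.le] at hp ⊢
    exact hasDerivAt_measureReal_Iic (ne_vec_mul h₁ h₂ j) (measurable_resetPDF _ _ _ _ _ _)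
      (resetPDF_nonneg hlam hξ hv j ht.le) (continuousAt_resetPDF hlam hξ hv hv₁ hv₂ j hx h₁ h₂)
  have hcdf : ∀ y, P.real {ω | resetPosition v₁ v₂ (R ω) (D ω) (J ω) t ≤ y} =
      q * (P.map fun ω => resetPosition v₁ v₂ (R ω) (D ω) 0 t).real (Iic y) +
        (1 - q) * (P.map fun ω => resetPosition v₁ v₂ (R ω) (D ω) 1 t).real (Iic y) := by
    intro y
    have hp := fun j => Measure.isProbabilityMeasure_map (μ := P)
      (h.measurable_resetPosition v₁ v₂ j t).aemeasurable
    refine (map_measureReal_apply (h.measurable_resetPosition_random v₁ v₂ t)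
      (measurableSet_Iic (a := y))).symm.trans ?_
    have hfin : ∀ (c : ℝ) (j : Fin 2), (ENNReal.ofReal c •
        P.map fun ω => resetPosition v₁ v₂ (R ω) (D ω) j t) (Iic y) ≠ ⊤ := fun c j =>
      ENNReal.mul_ne_top ENNReal.ofReal_ne_top (measure_ne_top _ _)
    rw [h.map_resetPosition_random, measureReal_add_apply (h₁ := hfin _ _) (h₂ := hfin _ _),
      measureReal_ennreal_smul_apply,
      measureReal_ennreal_smul_apply, ENNReal.toReal_ofReal hq₀,
      ENNReal.toReal_ofReal (sub_nonneg.2 hq₁)]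
  rw [h.mixedPDF_eq hlam hξ hv hv₁ hv₂ ht h₁ h₂]
  simp_rw [hcdf]
  exact ((hj 0).const_mul q).add ((hj 1).const_mul (1 - q))

lemma IsDriver.tendsto_mixedPDF [IsProbabilityMeasure P] (h : IsDriver P lam ξ q J R D)
    (hlam : 0 < lam) (hξ : 0 < ξ) (hv : v₂ < v₁) (hv₁ : v₁ ≠ 0) (hv₂ : v₂ ≠ 0) (x : ℝ) :
    Tendsto (fun t => mixedPDF P v₁ v₂ q R D x t) atTop
      (𝓝 ((q * Hbar lam ξ v₁ x + (1 - q) * Hbar lam ξ v₂ x) +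
        ∫ s in Ioi 0, ξ * Real.exp (-(ξ * s)) * telegraphPDF lam v₁ v₂ s x)) := by
  have hl := ((tendsto_resetPDF hlam hξ hv hv₁ hv₂ 0 x).const_mul q).add
    ((tendsto_resetPDF hlam hξ hv hv₁ hv₂ 1 x).const_mul (1 - q))
  have e : ∀ a b c : ℝ, q * (a + c) + (1 - q) * (b + c) = q * a + (1 - q) * b + c := by
    intro a b c; ring
  rw [e] at hl
  refine hl.congr' ?_
  -- Beyond `x / v₁` and `x / v₂` the point `x` is no longer an extreme, so `mixedPDF` is given by
  -- the explicit density.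
  filter_upwards [eventually_gt_atTop 0, eventually_gt_atTop (x / v₁),
    eventually_gt_atTop (x / v₂)] with t ht h1 h2
  refine (h.mixedPDF_eq hlam hξ hv hv₁ hv₂ ht ?_ ?_).symm
  · rintro rfl
    exact h1.ne (by field_simp)
  · rintro rfl
    exact h2.ne (by field_simp)

end ResetTelegraph

end

theorem mainTheorem10 {Ω : Type*} [MeasurableSpace Ω] (P : Measure Ω) [IsProbabilityMeasure P]
    (v₁ v₂ lam ξ q : ℝ) (hlam : 0 < lam) (hξ : 0 < ξ) (hq₀ : 0 ≤ q) (hq₁ : q ≤ 1)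
    (hv : (v₂ < 0 ∧ 0 < v₁) ∨ (0 < v₂ ∧ v₂ < v₁))
    (J : Ω → Fin 2) (R : Ω → ℕ → ℝ) (D : Ω → ℕ → Fin 2 → ℕ → ℝ)
    (hdriver : ResetTelegraph.IsDriver P lam ξ q J R D) :
    -- `mixedPDF` is the density of the absolutely continuous component of the position,
    (∀ t : ℝ, 0 < t →
      (P.map fun ω => ResetTelegraph.resetPosition v₁ v₂ (R ω) (D ω) (J ω) t).restrict
          ({v₁ * t, v₂ * t} : Set ℝ)ᶜ =
        volume.withDensity fun x =>
          ENNReal.ofReal (ResetTelegraph.mixedPDF P v₁ v₂ q R D x t)) ∧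
    -- and the derivative of the distribution function except at the origin and the two extremes
    (∀ t : ℝ, 0 < t → ∀ x : ℝ, x ≠ 0 → x ≠ v₁ * t → x ≠ v₂ * t →
      HasDerivAt
        (fun y => P.real {ω | ResetTelegraph.resetPosition v₁ v₂ (R ω) (D ω) (J ω) t ≤ y})
        (ResetTelegraph.mixedPDF P v₁ v₂ q R D x t) x) ∧
    -- its limit as time tends to infinity
    (∀ x : ℝ,
      (v₂ < 0 ∧ 0 < v₁ →
        Tendsto (fun t => ResetTelegraph.mixedPDF P v₁ v₂ q R D x t) atTop
          (𝓝 ((q * ResetTelegraph.Hbar lam ξ v₁ x + (1 - q) * ResetTelegraph.Hbar lam ξ v₂ x) +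
            ξ * Real.exp (ξ / lam) / (v₁ - v₂) *
              ResetTelegraph.upperIncGamma 0 ((max (x / v₁) (x / v₂) + 1 / lam) * ξ)))) ∧
      (0 < v₂ ∧ v₂ < v₁ →
        Tendsto (fun t => ResetTelegraph.mixedPDF P v₁ v₂ q R D x t) atTop
          (𝓝 ((q * ResetTelegraph.Hbar lam ξ v₁ x + (1 - q) * ResetTelegraph.Hbar lam ξ v₂ x) +
            ResetTelegraph.posIndicator x * (ξ * Real.exp (ξ / lam) / (v₁ - v₂)) *
              ResetTelegraph.genIncGamma 0 ((x / v₁ + 1 / lam) * ξ) ((x / v₂ + 1 / lam) * ξ))))) := by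
  have hlt : v₂ < v₁ := by
    rcases hv with h | h
    · exact h.1.trans h.2
    · exact h.2
  have hv₂ : v₂ ≠ 0 := by
    rcases hv with h | h
    · exact h.1.ne
    · exact h.1.ne'
  have hv₁ : v₁ ≠ 0 := by
    rcases hv with h | h
    · exact h.2.ne'
    · exact (h.1.trans h.2).ne'
  refine ⟨fun t ht => hdriver.restrict_map_resetPosition hlam hξ hq₀ hq₁ hlt hv₁ hv₂ ht,
    fun t ht x hx h₁ h₂ => hdriver.hasDerivAt_cdf hlam hξ hq₀ hq₁ hlt hv₁ hv₂ ht hx h₁ h₂,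
    fun x => ⟨fun h => ?_, fun h => ?_⟩⟩
  · rw [← ResetTelegraph.integral_spread_of_opposite hlam hξ h.1 h.2]
    exact hdriver.tendsto_mixedPDF hlam hξ hlt hv₁ hv₂ x
  · rw [← ResetTelegraph.integral_spread_of_pos hlam hξ h.1 h.2]
    exact hdriver.tendsto_mixedPDF hlam hξ hlt hv₁ hv₂ x
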